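/- Let $T$ be a finite group and let $\widehat T$ be the finite set of equivalence classes of its irreducible complex representations. For $n\ge 1$ let $\mathbb Y_n(\widehat T)$ be the set of tuples $\lambda=(\lambda^\zeta)_{\zeta\in\widehat T}$ of Young diagrams with $\sum_\zeta|\lambda^\zeta|=n$. For a Young diagram $\nu$ let $\dim\nu$ be the number of its standard tableaux, and put $$\dim\lambda=\frac{n!}{\prod_\zeta|\lambda^\zeta|!}\prod_\zeta(\dim\zeta)^{|\lambda^\zeta|}\dim\lambda^\zeta ,$$ the dimension of the irreducible representation of $T\wr\mathfrak S_n$ labelled by $\lambda$. Write $\nu\nearrow\lambda$ if $\lambda\in\mathbb Y_n(\widehat T)$ arises from $\nu\in\mathbb Y_{n-1}(\widehat T)$ by adding one box, and let $\zeta_{\nu\lambda}$ be the entry where it is added. For $\nu\nearrow\lambda$ and $\nu\nearrow\mu$ set $$P^\downarrow_{\lambda\nu}=\frac{\dim\zeta_{\nu\lambda}\dim\nu}{\dim\lambda},\qquad P^\uparrow_{\nu\mu}=\frac{\dim\zeta_{\nu\mu}\dim\mu}{n|T|\dim\nu}$$ (all other entries being $0$), and let $P^{(n)}=P^\downarrow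 P^\uparrow$. Let $\psi$ be a probability measure on $(0,\infty)$ with characteristic function $\varphi$. For each $n\ge1$, on some probability space, let $(Z^{(n)}_k)_{k\ge0}$ be a Markov chain on $\mathbb Y_n(\widehat T)$ with transition matrix $P^{(n)}$ and arbitrary initial distribution, and let $(\epsilon_j)_{j\ge1}$ be an i.i.d. sequence with law $\psi$, independent of $Z^{(n)}$. For $s\ge0$ let $X^{(n)}_s=Z^{(n)}_{N_s}$, where $N_s=j$ if $\epsilon_1+\dots+\epsilon_j\le s<\epsilon_1+\dots+\epsilon_{j+1}$. Put $$a(1,n,s)=\sum_{j=0}^\infty\Bigl(1-\frac1n\Bigr)^j\int_{[0,s]}\psi\bigl((s-u,\infty)\bigr)\,\psi^{*j}(du).$$ Assume that one of the following holds. 1. $\psi$ has a finite mean $m$ and $\int_{|u|\ge\delta}|\varphi(u)/u|\,du<\infty$ for some $\delta>0$; then put $\tau_n=n$ and $a_1(t)=e^{-t/m}$. 2. $\psi$ is the one-sided stable distribution of some exponent $\alpha\in(0,1)$, that is, $\varphi(u)=e^{-|u|^\alpha(1-i\tan(\pi\alpha/2)\,\mathrm{sgn}\,u)}$ for $u\in\mathbb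 R$; then put $\tau_n=n^{1/\alpha}$ and $$a_1(t)=\frac{\sin\pi\alpha}{\pi\alpha}\int_0^\infty\frac{e^{-t(u\cos(\pi\alpha/2))^{1/\alpha}}}{u^2+2u\cos\pi\alpha+1}\,du .$$ Assume moreover that there are real numbers $(n^\zeta)_{\zeta\in\widehat T}$ such that $\lim_{n\to\infty}\mathbb E\bigl[|X^{(n)\zeta}_0|/n\bigr]=n^\zeta$ for every $\zeta\in\widehat T$. Then, for every $t\ge0$, $\lim_{n\to\infty}a(1,n,t\tau_n)=a_1(t)$, and for every $\zeta\in\widehat T$ $$\lim_{n\to\infty}\mathbb E\Bigl[\frac{|X^{(n)\zeta}_{t\tau_n}|}{n}\Bigr]=(1-a_1(t))\frac{(\dim\zeta)^2}{|T|}+a_1(t)\,n^\zeta .$$ In particular, as $t\to\infty$ the right-hand side tends, for every $\zeta\in\widehat T$, to $(\dim\zeta)^2/|T|$, the Plancherel measure of $T$. -/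

import Mathlib

open MeasureTheory ProbabilityTheory Filter Topology

noncomputable section

namespace ResInd

/-! ## The dual of a finite group -/

/-- An irreducible complex matrix representation of `T` (every finite-dimensional complex
representation is equivalent to one on some `ℂ^d`). -/
structure IrrepModel (T : Type*) [Group T] where
  dim : ℕ
  rep : Representation ℂ T (Fin dim → ℂ)
  irreducible : rep.IsIrreducible

/-- Equivalence of representations. -/
def irrepSetoid (T : Type*) [Group T] : Setoid (IrrepModel T) where
  r ρ σ := Nonempty (ρ.rep.Equiv σ.rep)
  iseqv :=
    { refl := fun _ => ⟨Representation.Equiv.refl _⟩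
      symm := fun ⟨e⟩ => ⟨e.symm⟩
      trans := fun ⟨e⟩ ⟨f⟩ => ⟨e.trans f⟩ }

/-- `T^`, the set of equivalence classes of irreducible complex representations of `T`. -/
def Irr (T : Type*) [Group T] := Quotient (irrepSetoid T)

/-- The dimension of (a representative of) an equivalence class. -/
def Irr.dim {T : Type*} [Group T] : Irr T → ℕ :=
  Quotient.lift IrrepModel.dim (by
    rintro ρ σ ⟨e⟩
    simpa using e.toLinearEquiv.finrank_eq)

/-- A finite group has finitely many irreducible representations up to equivalence, by linear
independence of the irreducible characters. -/
instance finite_irr (T : Type*) [Group T] [Finite T] : Finite (Irr T) := by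
  classical
  have := Fintype.ofFinite T
  have hT : (Nat.card T : ℂ) ≠ 0 := by simp
  have : Invertible (Nat.card T : ℂ) := invertibleOfNonzero hT
  let rp : Irr T → IrrepModel T := fun ζ => Quotient.out ζ
  let χ : Irr T → T → ℂ := fun ζ => (rp ζ).rep.character
  have hirr : ∀ ζ : Irr T, (rp ζ).rep.IsIrreducible := fun ζ => (rp ζ).irreducible
  have key : ∀ ζ η : Irr T, (Nat.card T : ℂ)⁻¹ * ∑ g : T, χ ζ g * χ η g⁻¹
      = if ζ = η then 1 else 0 := by
    intro ζ η
    have := hirr ζ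
    have := hirr η
    have h := Representation.char_orthonormal (rp ζ).rep (rp η).rep
    have hiff : Nonempty ((rp η).rep.Equiv (rp ζ).rep) ↔ ζ = η := by
      constructor
      · intro h'
        exact (Quotient.out_equiv_out (s := irrepSetoid T).1 h').symm
      · rintro rfl
        exact ⟨Representation.Equiv.refl _⟩
    simp only [hiff] at h
    exact h
  have hli : LinearIndependent ℂ χ := by
    rw [linearIndependent_iff']
    intro s c hc i hi
    have h1 : ∀ g : T, ∑ ζ ∈ s, c ζ * χ ζ g = 0 := by
      intro g
      have := congrFun hc g
      simpa using this
    have h2 : ∑ ζ ∈ s, c ζ * ((Nat.card T : ℂ)⁻¹ * ∑ g : T, χ ζ g * χ i g⁻¹) = 0 := by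
      calc ∑ ζ ∈ s, c ζ * ((Nat.card T : ℂ)⁻¹ * ∑ g : T, χ ζ g * χ i g⁻¹)
          = (Nat.card T : ℂ)⁻¹ * ∑ g : T, (∑ ζ ∈ s, c ζ * χ ζ g) * χ i g⁻¹ := by
            simp only [Finset.mul_sum, Finset.sum_mul]
            rw [Finset.sum_comm]
            refine Finset.sum_congr rfl fun g _ => Finset.sum_congr rfl fun ζ _ => ?_
            ring
        _ = 0 := by simp [h1]
    simp only [key] at h2
    simpa [hi] using h2
  exact hli.finite

instance fintypeIrr (T : Type*) [Group T] [Finite T] : Fintype (Irr T) := Fintype.ofFinite _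

/-- The Plancherel measure of `T`, as a weight function on the dual of `T`. -/
def plancherel {T : Type*} [Group T] (ζ : Irr T) : ℝ := (ζ.dim : ℝ) ^ 2 / Nat.card T

/-! ## Young diagrams and multiple Young diagrams -/

/-- The dimension of a Young diagram: the number of its standard tableaux, i.e. of the bijective
fillings of its cells by `0, …, |ν| - 1` that increase along rows and columns. -/
def youngDim (ν : YoungDiagram) : ℕ :=
  Nat.card {f : ν.cells ≃ Fin ν.card // Monotone f}

variable {T : Type*} [Group T] [Finite T]

/-- `𝕐_n(T^)`: tuples of Young diagrams indexed by the dual of `T` with `n` boxes in total. -/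
def MultiDiagram (T : Type*) [Group T] [Finite T] (n : ℕ) :=
  {l : Irr T → YoungDiagram // ∑ ζ, (l ζ).card = n}

/-- The entry of a multiple diagram at `ζ`. -/
def MultiDiagram.entry {n : ℕ} (l : MultiDiagram T n) (ζ : Irr T) : YoungDiagram := l.1 ζ

instance finite_multiDiagram (n : ℕ) : Finite (MultiDiagram T n) := by
  have hfin : Finite {ν : YoungDiagram // ν.card ≤ n} := by
    let f : {ν : YoungDiagram // ν.card ≤ n} →
        ((Finset.range n ×ˢ Finset.range n).powerset : Finset (Finset (ℕ × ℕ))) := fun ν =>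
      ⟨ν.1.cells, by
        rw [Finset.mem_powerset]
        rintro ⟨i, j⟩ hc
        have hc' : (i, j) ∈ ν.1 := hc
        have hcol : i < ν.1.colLen j := YoungDiagram.mem_iff_lt_colLen.1 hc'
        have hrow : j < ν.1.rowLen i := YoungDiagram.mem_iff_lt_rowLen.1 hc'
        have h1 : ν.1.colLen j ≤ ν.1.card := by
          rw [YoungDiagram.colLen_eq_card]
          exact Finset.card_le_card (Finset.filter_subset _ _)
        have h2 : ν.1.rowLen i ≤ ν.1.card := by
          rw [YoungDiagram.rowLen_eq_card]
          exact Finset.card_le_card (Finset.filter_subset _ _)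
        have := ν.2
        simp only [Finset.mem_product, Finset.mem_range]
        omega⟩
    refine Finite.of_injective f ?_
    intro μ ν h
    apply Subtype.ext
    apply YoungDiagram.ext
    exact congrArg Subtype.val h
  let g : MultiDiagram T n → (Irr T → {ν : YoungDiagram // ν.card ≤ n}) := fun l ζ =>
    ⟨l.1 ζ, by
      calc (l.1 ζ).card ≤ ∑ η, (l.1 η).card :=
            Finset.single_le_sum (f := fun η => (l.1 η).card) (fun _ _ => Nat.zero_le _)
              (Finset.mem_univ ζ)
        _ = n := l.2⟩
  refine Finite.of_injective g ?_
  intro l m h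
  apply Subtype.ext
  funext ζ
  exact congrArg Subtype.val (congrFun h ζ)

instance fintypeMultiDiagram (n : ℕ) : Fintype (MultiDiagram T n) := Fintype.ofFinite _

/-- The finite set of multiple diagrams carries the discrete σ-algebra. -/
instance measurableSpaceMultiDiagram (n : ℕ) : MeasurableSpace (MultiDiagram T n) := ⊤

/-- The dimension of the irreducible representation of `T ≀ 𝔖_n` labelled by `l`:
`n! / ∏ |l^ζ|! * ∏ (dim ζ)^|l^ζ| * dim l^ζ`. -/
def MultiDiagram.dim {n : ℕ} (l : MultiDiagram T n) : ℝ :=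
  (n.factorial : ℝ) / (∏ ζ, ((l.entry ζ).card.factorial : ℝ)) *
    ∏ ζ, ((ζ.dim : ℝ) ^ (l.entry ζ).card * (youngDim (l.entry ζ) : ℝ))

/-- `l` is obtained from `ν` by adding one box at the entry `ζ`. -/
def AddsBoxAt {m n : ℕ} (ζ : Irr T) (ν : MultiDiagram T m) (l : MultiDiagram T n) : Prop :=
  ν.entry ζ ≤ l.entry ζ ∧ (l.entry ζ).card = (ν.entry ζ).card + 1 ∧
    ∀ η, η ≠ ζ → l.entry η = ν.entry η

open Classical in
/-- The branching multiplicity: `dim ζ` if `l` is obtained from `ν` by adding a box at the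
(necessarily unique) entry `ζ`, and `0` if `l` is not obtained from `ν` by adding a box. -/
def branchMult {m n : ℕ} (ν : MultiDiagram T m) (l : MultiDiagram T n) : ℝ :=
  ∑ ζ, if AddsBoxAt ζ ν l then (ζ.dim : ℝ) else 0

/-! ## The Res-Ind chain -/

/-- Restriction step `P↓` from `n` boxes to `n - 1` boxes. -/
def down {n : ℕ} (l : MultiDiagram T n) (ν : MultiDiagram T (n - 1)) : ℝ :=
  branchMult ν l * ν.dim / l.dim

/-- Induction step `P↑` from `n - 1` boxes to `n` boxes. -/
def up {n : ℕ} (ν : MultiDiagram T (n - 1)) (μ : MultiDiagram T n) : ℝ :=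
  branchMult ν μ * μ.dim / (n * Nat.card T * ν.dim)

/-- The transition matrix `P = P↓ P↑` of the Res-Ind chain (for `n ≥ 1`). -/
def resInd (T : Type*) [Group T] [Finite T] (n : ℕ) :
    Matrix (MultiDiagram T n) (MultiDiagram T n) ℝ :=
  fun l μ => ∑ ν : MultiDiagram T (n - 1), down l ν * up ν μ

/-- The counting process: the number `j` with `ε_1 + ⋯ + ε_j ≤ s < ε_1 + ⋯ + ε_{j+1}`
(here `ε_{j+1}` is written `ε j`). -/
def count (ε : ℕ → ℝ) (s : ℝ) : ℕ := sSup {j : ℕ | ∑ i ∈ Finset.range j, ε i ≤ s}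

/-- `Z` is a Markov chain with transition matrix `P^{(n)}` and arbitrary initial distribution, and
`ε` is an i.i.d. sequence with common law `ψ`, independent of `Z`. -/
structure IsPausedChain {n : ℕ} (ψ : Measure ℝ) {Ω : Type*} [MeasurableSpace Ω] (Pr : Measure Ω)
    (Z : ℕ → Ω → MultiDiagram T n) (ε : ℕ → Ω → ℝ) : Prop where
  measurable_chain : ∀ k, Measurable (Z k)
  markov : ∀ (k : ℕ) (x : ℕ → MultiDiagram T n),
    Pr.real {ω | ∀ i ≤ k + 1, Z i ω = x i} =
      Pr.real {ω | ∀ i ≤ k, Z i ω = x i} * resInd T n (x k) (x (k + 1))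
  measurable_pause : ∀ j, Measurable (ε j)
  law_pause : ∀ j, Pr.map (ε j) = ψ
  iIndep_pause : iIndepFun ε Pr
  indep_chain_pause : IndepFun (fun ω k => Z k ω) (fun ω j => ε j ω) Pr

/-- The continuous time process `X_s = Z_{N_s}`. -/
def process {n : ℕ} {Ω : Type*} (Z : ℕ → Ω → MultiDiagram T n) (ε : ℕ → Ω → ℝ) (s : ℝ) (ω : Ω) :
    MultiDiagram T n :=
  Z (count (fun j => ε j ω) s) ω

/-- The averaged normalized size `𝔼[|X_s^ζ| / n]`. -/
def meanSize {n : ℕ} {Ω : Type*} [MeasurableSpace Ω] (Pr : Measure Ω)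
    (Z : ℕ → Ω → MultiDiagram T n) (ε : ℕ → Ω → ℝ) (ζ : Irr T) (s : ℝ) : ℝ :=
  ∫ ω, (((process Z ε s ω).entry ζ).card : ℝ) / n ∂Pr

/-! ## Pausing time distributions -/

/-- The convolution power `ψ^{*j}`. -/
def convPow (ψ : Measure ℝ) : ℕ → Measure ℝ
  | 0 => Measure.dirac 0
  | j + 1 => (convPow ψ j).conv ψ

/-- `a(k,n,s) = ∑_j (1 - k/n)^j ∫_{[0,s]} ψ((s-u,∞)) ψ^{*j}(du)`. -/
def pauseCoeff (ψ : Measure ℝ) (k n : ℕ) (s : ℝ) : ℝ :=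
  ∑' j : ℕ, (1 - (k : ℝ) / n) ^ j *
    ∫ u in Set.Icc 0 s, ψ.real (Set.Ioi (s - u)) ∂(convPow ψ j)

/-- `ψ` has a (finite) mean and its characteristic function `φ` satisfies
`∫_{|u| ≥ δ} |φ(u)/u| du < ∞` for some `δ > 0` (equivalently, as `|φ| ≤ 1`, for all `δ > 0`). -/
def IsFiniteMeanPausing (ψ : Measure ℝ) : Prop :=
  Integrable (fun x : ℝ => x) ψ ∧
    ∃ δ : ℝ, 0 < δ ∧ IntegrableOn (fun u : ℝ => charFun ψ u / (u : ℂ)) {u : ℝ | δ ≤ |u|}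

/-- `ψ` is the one-sided stable distribution of exponent `α`, with characteristic function
`exp (-|u|^α (1 - i tan(πα/2) sgn u))`. -/
def IsOneSidedStable (α : ℝ) (ψ : Measure ℝ) : Prop :=
  ∀ u : ℝ, charFun ψ u =
    Complex.exp (-((|u| ^ α : ℝ) : ℂ) *
      (1 - Complex.I * ((Real.tan (Real.pi * α / 2) * Real.sign u : ℝ) : ℂ)))

/-- `e^{-kt/m}` where `m` is the mean of `ψ`. -/
def finiteMeanCoeff (ψ : Measure ℝ) (k : ℕ) (t : ℝ) : ℝ :=
  Real.exp (-(k * t / ∫ x, x ∂ψ))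

/-- `(sin πα / πα) ∫_0^∞ exp(-t (k u cos(πα/2))^{1/α}) / (u² + 2 u cos πα + 1) du`. -/
def stableCoeff (α : ℝ) (k : ℕ) (t : ℝ) : ℝ :=
  Real.sin (Real.pi * α) / (Real.pi * α) *
    ∫ u in Set.Ioi (0 : ℝ),
      Real.exp (-(t * (k * u * Real.cos (Real.pi * α / 2)) ^ (1 / α))) /
        (u ^ 2 + 2 * u * Real.cos (Real.pi * α) + 1)

end ResInd

end

/-!
The statement splits into a combinatorial part, a probabilistic part and an analytic part.

*Combinatorics.* The function `l ↦ |l^ζ|` on multiple diagrams is, up to an additive constant, an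
eigenfunction of the Res-Ind transition matrix with eigenvalue `1 - 1/n` (`sum_resInd_mul_card`).
Indeed the restriction step removes a box at `ζ` with probability `|l^ζ| / n`, by the branching
rule for standard tableaux (`youngDim_eq_sum_lower`), and the induction step adds one with
probability `(dim ζ)² / |T|`, by the dual branching rule (`sum_upper_youngDim`). The latter says
that the up and down operators of the Young graph have commutator the identity, which rests on two
facts: a diagram has one more addable box than removable boxes, and two distinct diagrams of equal
size have a common upper neighbour iff they have a common lower one.

*Probability.* Hence the mean of `|Z_k^ζ| / n` relaxes geometrically to the Plancherel weight of
`ζ`. The pausing times are independent of the chain, so the mean along the paused process is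
obtained by averaging `(1 - 1/n)^j` over the number `j` of renewals before time `s`, and this
average is exactly `a(1, n, s)` (`IsPausedChain.meanSize_eq`). It remains to find the limit of
`a(1, n, t τ_n)`.

*Analysis.* Summation by parts gives `a(1, n, s) = 1 - (1/n) ∑_j (1 - 1/n)^j P(S_{j+1} ≤ s)`,
where `S_j` is the `j`-th renewal epoch. With `j = ⌊n x⌋` this is an integral over `x`, and it
converges to `1 - ∫ e^{-x} G(x) dx` as soon as `P(S_{⌊n x⌋ + 1} ≤ t τ_n) → G(x)` for almost every
`x` (`tendsto_pauseCoeff`).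

* If `ψ` has mean `m`, the strong law of large numbers makes `G` the indicator of `x < t/m`,
  whence the limit `e^{-t/m}`.
* If `ψ` is stable, `S_j` has the law of `j^{1/α} S_1`, so `G(x) = P(x^{1/α} S_1 ≤ t)` and the
  limit is `P(e^{1/α} S_1 > t)` with `e` an independent exponential variable. The characteristic
  function of `e^{1/α} S_1` is `1 / (1 + θ)`, where `θ` is the stable exponent. The integral that
  defines the coefficient is the tail of a mixture of exponential laws, and Cauchy's formula on
  the plane cut along the negative half-line (`tendsto_integral_jump_mul`,
  `integral_stableWeight_mul`) shows that this mixture has the same characteristic function. So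
  the two laws agree.
-/

open MeasureTheory ProbabilityTheory Filter Topology

noncomputable section

namespace ResInd

/-! ### The Young graph -/

open Classical in
/-- The rows of `ν` at the end of which a box may be added. -/
def growRows (ν : YoungDiagram) : Finset ℕ :=
  {i ∈ Finset.range (ν.colLen 0 + 1) | i = 0 ∨ ν.rowLen i < ν.rowLen (i - 1)}

open Classical in
/-- The rows of `ν` whose last box may be removed. -/
def shrinkRows (ν : YoungDiagram) : Finset ℕ :=
  {i ∈ Finset.range (ν.colLen 0) | ν.rowLen (i + 1) < ν.rowLen i}

theorem lt_colLen_of_rowLen_pos {ν : YoungDiagram} {i : ℕ} (h : 0 < ν.rowLen i) :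
    i < ν.colLen 0 :=
  YoungDiagram.mem_iff_lt_colLen.1 (YoungDiagram.mem_iff_lt_rowLen.2 h)

theorem mem_growRows {ν : YoungDiagram} {i : ℕ} :
    i ∈ growRows ν ↔ i = 0 ∨ ν.rowLen i < ν.rowLen (i - 1) := by
  simp only [growRows, Finset.mem_filter, Finset.mem_range, and_iff_right_iff_imp]
  rintro (rfl | h)
  · omega
  · have := lt_colLen_of_rowLen_pos (ν := ν) (i := i - 1) (by omega)
    omega

theorem mem_shrinkRows {ν : YoungDiagram} {i : ℕ} :
    i ∈ shrinkRows ν ↔ ν.rowLen (i + 1) < ν.rowLen i := by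
  simp only [shrinkRows, Finset.mem_filter, Finset.mem_range, and_iff_right_iff_imp]
  exact fun h => lt_colLen_of_rowLen_pos (by omega)

theorem card_growRows (ν : YoungDiagram) : (growRows ν).card = (shrinkRows ν).card + 1 := by
  have h : growRows ν = insert 0 ((shrinkRows ν).image Nat.succ) := by
    ext i
    simp only [mem_growRows, Finset.mem_insert, Finset.mem_image, mem_shrinkRows]
    constructor
    · rintro (h | h)
      · exact Or.inl h
      · by_cases hi : i = 0
        · exact Or.inl hi
        · refine Or.inr ⟨i - 1, ?_, by omega⟩
          rwa [Nat.sub_add_cancel (by omega)]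
    · rintro (h | ⟨k, hk, rfl⟩)
      · exact Or.inl h
      · exact Or.inr hk
  rw [h, Finset.card_insert_of_notMem (by simp),
    Finset.card_image_of_injective _ Nat.succ_injective]

/-- `ν` with a box added at the end of row `i`. -/
def addRow (ν : YoungDiagram) (i : ℕ) (h : i ∈ growRows ν) : YoungDiagram where
  cells := insert (i, ν.rowLen i) ν.cells
  isLowerSet := by
    rintro ⟨p, q⟩ ⟨p', q'⟩ hab hb
    simp only [Finset.coe_insert, Set.mem_insert_iff, Finset.mem_coe, YoungDiagram.mem_cells,
      Prod.mk.injEq] at hb ⊢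
    obtain ⟨h1, h2⟩ := Prod.mk_le_mk.1 hab
    rcases hb with ⟨rfl, rfl⟩ | hb
    · rcases Nat.lt_or_ge p' p with hp | hp
      · right
        rw [YoungDiagram.mem_iff_lt_rowLen]
        rcases mem_growRows.1 h with h | h
        · omega
        · have := ν.rowLen_anti p' (p - 1) (by omega)
          omega
      · have : p' = p := by omega
        subst this
        rcases Nat.lt_or_ge q' (ν.rowLen p') with hq | hq
        · exact Or.inr (YoungDiagram.mem_iff_lt_rowLen.2 hq)
        · left; omega
    · exact Or.inr (ν.up_left_mem h1 h2 hb)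

/-- `ν` with the last box of row `i` removed. -/
def removeRow (ν : YoungDiagram) (i : ℕ) (h : i ∈ shrinkRows ν) : YoungDiagram where
  cells := ν.cells.erase (i, ν.rowLen i - 1)
  isLowerSet := by
    rintro ⟨p, q⟩ ⟨p', q'⟩ hab hb
    simp only [Finset.coe_erase, Set.mem_sdiff, Finset.mem_coe, YoungDiagram.mem_cells,
      Set.mem_singleton_iff, Prod.mk.injEq] at hb ⊢
    obtain ⟨h1, h2⟩ := Prod.mk_le_mk.1 hab
    refine ⟨ν.up_left_mem h1 h2 hb.1, ?_⟩
    rintro ⟨rfl, rfl⟩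
    have h3 := YoungDiagram.mem_iff_lt_rowLen.1 hb.1
    have h4 := mem_shrinkRows.1 h
    rcases Nat.lt_or_ge p' p with hp | hp
    · have := ν.rowLen_anti (p' + 1) p hp
      omega
    · have hp : p' = p := by omega
      subst hp
      exact hb.2 ⟨rfl, by omega⟩

open Classical in
/-- The diagrams obtained from `ν` by adding one box. -/
def upper (ν : YoungDiagram) : Finset YoungDiagram :=
  (growRows ν).attach.image fun i => addRow ν i.1 i.2

open Classical in
/-- The diagrams obtained from `ν` by removing one box. -/
def lower (ν : YoungDiagram) : Finset YoungDiagram :=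
  (shrinkRows ν).attach.image fun i => removeRow ν i.1 i.2

theorem exists_insert_cells {ν μ : YoungDiagram} (h : ν ≤ μ) (hc : μ.card = ν.card + 1) :
    ∃ c, c ∉ ν.cells ∧ μ.cells = insert c ν.cells := by
  have hs := YoungDiagram.cells_subset_iff.2 h
  have h1 : (μ.cells \ ν.cells).card = 1 := by
    rw [Finset.card_sdiff_of_subset hs]
    change μ.card - ν.card = 1
    omega
  obtain ⟨c, hc⟩ := Finset.card_eq_one.1 h1
  refine ⟨c, ?_, ?_⟩
  · have : c ∈ μ.cells \ ν.cells := by simp [hc]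
    exact (Finset.mem_sdiff.1 this).2
  · rw [Finset.insert_eq, ← hc, Finset.sdiff_union_of_subset hs]

theorem mem_upper {ν μ : YoungDiagram} : μ ∈ upper ν ↔ ν ≤ μ ∧ μ.card = ν.card + 1 := by
  simp only [upper, Finset.mem_image, Finset.mem_attach, true_and, Subtype.exists]
  constructor
  · rintro ⟨i, hi, rfl⟩
    refine ⟨YoungDiagram.cells_subset_iff.1 (Finset.subset_insert _ _), ?_⟩
    refine Finset.card_insert_of_notMem ?_
    simp [YoungDiagram.mem_iff_lt_rowLen]
  · rintro ⟨hle, hc⟩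
    obtain ⟨⟨i, j⟩, hn, he⟩ := exists_insert_cells hle hc
    have hm : ∀ a b, (a, b) ∈ μ ↔ (a = i ∧ b = j) ∨ b < ν.rowLen a := by
      intro a b
      rw [← YoungDiagram.mem_cells, he, Finset.mem_insert, YoungDiagram.mem_cells,
        YoungDiagram.mem_iff_lt_rowLen, Prod.mk.injEq]
    have hn' : ν.rowLen i ≤ j := by
      simpa [YoungDiagram.mem_iff_lt_rowLen] using hn
    have hij : (i, j) ∈ μ := (hm i j).2 (Or.inl ⟨rfl, rfl⟩)
    have hj : j = ν.rowLen i := by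
      by_contra hne
      have := (hm i (ν.rowLen i)).1 (μ.up_left_mem le_rfl hn' hij)
      omega
    have hi : i ∈ growRows ν := by
      rw [mem_growRows]
      by_cases h0 : i = 0
      · exact Or.inl h0
      · have := (hm (i - 1) j).1 (μ.up_left_mem (Nat.sub_le _ _) le_rfl hij)
        right
        omega
    refine ⟨i, hi, ?_⟩
    apply YoungDiagram.ext
    rw [he, hj]
    rfl

theorem mem_lower {ν μ : YoungDiagram} : ν ∈ lower μ ↔ ν ≤ μ ∧ μ.card = ν.card + 1 := by
  simp only [lower, Finset.mem_image, Finset.mem_attach, true_and, Subtype.exists]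
  constructor
  · rintro ⟨i, hi, rfl⟩
    refine ⟨YoungDiagram.cells_subset_iff.1 (Finset.erase_subset _ _), ?_⟩
    refine (Finset.card_erase_add_one ?_).symm
    have := mem_shrinkRows.1 hi
    rw [YoungDiagram.mem_cells, YoungDiagram.mem_iff_lt_rowLen]
    omega
  · rintro ⟨hle, hc⟩
    obtain ⟨⟨i, j⟩, hn, he⟩ := exists_insert_cells hle hc
    have hm : ∀ a b, b < μ.rowLen a ↔ (a = i ∧ b = j) ∨ (a, b) ∈ ν := by
      intro a b
      rw [← YoungDiagram.mem_iff_lt_rowLen, ← YoungDiagram.mem_cells, he, Finset.mem_insert,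
        YoungDiagram.mem_cells, Prod.mk.injEq]
    have hn' : (i, j) ∉ ν := hn
    have hij : j < μ.rowLen i := (hm i j).2 (Or.inl ⟨rfl, rfl⟩)
    have hj : j = μ.rowLen i - 1 := by
      by_contra hne
      rcases (hm i (j + 1)).1 (by omega) with h | h
      · omega
      · exact hn' (ν.up_left_mem le_rfl (Nat.le_succ _) h)
    have hi : i ∈ shrinkRows μ := by
      rw [mem_shrinkRows]
      by_contra hlt
      rcases (hm (i + 1) j).1 (by omega) with h | h
      · omega
      · exact hn' (ν.up_left_mem (Nat.le_succ _) le_rfl h)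
    refine ⟨i, hi, ?_⟩
    apply YoungDiagram.ext
    change μ.cells.erase (i, μ.rowLen i - 1) = ν.cells
    rw [← hj, he, Finset.erase_insert hn]

theorem mem_upper_iff_mem_lower {ν μ : YoungDiagram} : μ ∈ upper ν ↔ ν ∈ lower μ := by
  rw [mem_upper, mem_lower]

theorem card_upper (ν : YoungDiagram) : (upper ν).card = (lower ν).card + 1 := by
  classical
  rw [upper, lower, Finset.card_image_of_injective, Finset.card_image_of_injective,
    Finset.card_attach, Finset.card_attach, card_growRows]
  · rintro ⟨i, hi⟩ ⟨k, hk⟩ h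
    have h' : ν.cells.erase (i, ν.rowLen i - 1) = ν.cells.erase (k, ν.rowLen k - 1) :=
      congrArg YoungDiagram.cells h
    have hmem : (i, ν.rowLen i - 1) ∈ ν.cells := by
      have := mem_shrinkRows.1 hi
      rw [YoungDiagram.mem_cells, YoungDiagram.mem_iff_lt_rowLen]
      omega
    exact Subtype.ext (congrArg Prod.fst ((Finset.erase_inj ν.cells hmem).1 h'))
  · rintro ⟨i, hi⟩ ⟨k, hk⟩ h
    have h' : insert (i, ν.rowLen i) ν.cells = insert (k, ν.rowLen k) ν.cells :=
      congrArg YoungDiagram.cells h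
    have hmem : (i, ν.rowLen i) ∉ ν.cells := by
      simp [YoungDiagram.mem_iff_lt_rowLen]
    exact Subtype.ext (congrArg Prod.fst ((Finset.insert_inj hmem).1 h'))

theorem lower_nonempty {ν : YoungDiagram} (h : ν.card ≠ 0) : (lower ν).Nonempty := by
  classical
  have hne : ν.cells.Nonempty := Finset.card_ne_zero.1 h
  obtain ⟨⟨a, b⟩, hab⟩ := hne
  have h0 : a < ν.colLen 0 :=
    YoungDiagram.mem_iff_lt_colLen.1 (ν.up_left_mem le_rfl (Nat.zero_le b) hab)
  have hi : ν.colLen 0 - 1 ∈ shrinkRows ν := by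
    rw [mem_shrinkRows]
    have h1 : (ν.colLen 0 - 1, 0) ∈ ν := YoungDiagram.mem_iff_lt_colLen.2 (by omega)
    have h2 := YoungDiagram.mem_iff_lt_rowLen.1 h1
    by_contra hlt
    have := lt_colLen_of_rowLen_pos (ν := ν) (i := ν.colLen 0 - 1 + 1) (by omega)
    omega
  exact ⟨removeRow ν _ hi, Finset.mem_image.2 ⟨⟨_, hi⟩, Finset.mem_attach _ _, rfl⟩⟩

/-! ### Standard tableaux and the dimension of a Young diagram -/

/-- Standard tableaux of shape `ν`, encoded as functions on `ℕ × ℕ` that vanish off `ν`. -/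
def tableaux (ν : YoungDiagram) : Set (ℕ × ℕ → ℕ) :=
  {g | (∀ c ∉ ν.cells, g c = 0) ∧ Set.BijOn g ν.cells (Set.Iio ν.card) ∧
    MonotoneOn g (ν.cells : Set (ℕ × ℕ))}

/-- A standard filling of the cells of `ν`, extended by zero. -/
def toTableaux (ν : YoungDiagram) (f : {f : ν.cells ≃ Fin ν.card // Monotone f}) :
    tableaux ν := by
  classical
  refine ⟨fun c => if h : c ∈ ν.cells then (f.1 ⟨c, h⟩ : ℕ) else 0, ?_, ⟨?_, ?_, ?_⟩, ?_⟩
  · intro c hc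
    simp [hc]
  · intro c hc
    have hc' : c ∈ ν.cells := hc
    simp only [hc', dite_true, Set.mem_Iio]
    exact (f.1 ⟨c, hc'⟩).2
  · intro c hc d hd h
    have hc' : c ∈ ν.cells := hc
    have hd' : d ∈ ν.cells := hd
    simp only [hc', hd', dite_true] at h
    exact congrArg Subtype.val (f.1.injective (Fin.ext h))
  · intro k hk
    refine ⟨(f.1.symm ⟨k, hk⟩).1, (f.1.symm ⟨k, hk⟩).2, ?_⟩
    simp
  · intro c hc d hd h
    have hc' : c ∈ ν.cells := hc
    have hd' : d ∈ ν.cells := hd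
    simp only [hc', hd', dite_true]
    exact f.2 (show (⟨c, hc'⟩ : ν.cells) ≤ ⟨d, hd'⟩ from h)

theorem toTableaux_bijective (ν : YoungDiagram) : Function.Bijective (toTableaux ν) := by
  classical
  constructor
  · intro f f' h
    apply Subtype.ext
    ext ⟨c, hc⟩
    have := congrFun (congrArg Subtype.val h) c
    simpa only [toTableaux, hc, dite_true] using this
  · rintro ⟨g, h0, hb, hm⟩
    have hbij : Function.Bijective
        (fun c : ν.cells => (⟨g c.1, hb.mapsTo c.2⟩ : Fin ν.card)) := by
      constructor
      · intro c d h
        exact Subtype.ext (hb.injOn c.2 d.2 (congrArg Fin.val h))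
      · rintro ⟨k, hk⟩
        obtain ⟨c, hc, rfl⟩ := hb.surjOn hk
        exact ⟨⟨c, hc⟩, rfl⟩
    refine ⟨⟨Equiv.ofBijective _ hbij, ?_⟩, ?_⟩
    · intro c d h
      exact hm c.2 d.2 h
    · apply Subtype.ext
      funext c
      by_cases hc : c ∈ ν.cells
      · simp only [toTableaux, hc, dite_true, Equiv.ofBijective_apply]
      · simp only [toTableaux, hc, dite_false, h0 c hc]

theorem youngDim_eq (ν : YoungDiagram) : youngDim ν = Nat.card (tableaux ν) :=
  Nat.card_eq_of_bijective _ (toTableaux_bijective ν)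

instance finite_tableaux (ν : YoungDiagram) : Finite (tableaux ν) :=
  Finite.of_surjective _ (toTableaux_bijective ν).surjective

open Classical in
/-- A tableau of shape `ν ∈ lower μ` with the largest label put into the remaining box of `μ`. -/
def extendTableau (μ : YoungDiagram) (p : Σ ν : lower μ, tableaux ν.1) : tableaux μ := by
  refine ⟨fun c => if c ∈ μ.cells ∧ c ∉ p.1.1.cells then p.1.1.card else p.2.1 c, ?_⟩
  obtain ⟨⟨ν, hν⟩, ⟨g, h0, hb, hm⟩⟩ := p
  obtain ⟨hle, hcard⟩ := mem_lower.1 hν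
  obtain ⟨c, hc, he⟩ := exists_insert_cells hle hcard
  have hval : ∀ d ∈ ν.cells, (if d ∈ μ.cells ∧ d ∉ ν.cells then ν.card else g d) = g d := by
    intro d hd
    simp [hd]
  have hvalc : (if c ∈ μ.cells ∧ c ∉ ν.cells then ν.card else g c) = ν.card := by
    simp [he, hc]
  refine ⟨?_, ?_, ?_⟩
  · intro d hd
    simp only [hd, false_and, if_false]
    exact h0 d fun h => hd (YoungDiagram.cells_subset_iff.2 hle h)
  · have hb' : Set.BijOn (fun d => if d ∈ μ.cells ∧ d ∉ ν.cells then ν.card else g d)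
        ν.cells (Set.Iio ν.card) := hb.congr fun d hd => (hval d hd).symm
    have hins := hb'.insert (a := c)
      (by simp only [hvalc, Set.mem_Iio, lt_irrefl, not_false_eq_true])
    simp only [hvalc] at hins
    have hI : Set.Iio μ.card = insert ν.card (Set.Iio ν.card) := by
      ext k
      simp only [Set.mem_Iio, Set.mem_insert_iff]
      omega
    have hM : (μ.cells : Set (ℕ × ℕ)) = insert c (ν.cells : Set (ℕ × ℕ)) := by
      rw [he, Finset.coe_insert]
    rw [hI, hM]
    exact hins
  · intro a ha b hb'' hab
    have ha' : a ∈ μ.cells := ha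
    have hb3 : b ∈ μ.cells := hb''
    change (if a ∈ μ.cells ∧ a ∉ ν.cells then ν.card else g a) ≤
      (if b ∈ μ.cells ∧ b ∉ ν.cells then ν.card else g b)
    by_cases hbν : b ∈ ν.cells
    · have haν : a ∈ ν.cells := ν.isLowerSet hab hbν
      rw [hval a haν, hval b hbν]
      exact hm haν hbν hab
    · rw [if_pos (show b ∈ μ.cells ∧ b ∉ ν.cells from ⟨hb3, hbν⟩)]
      split_ifs with h
      · exact le_rfl
      · have haν : a ∈ ν.cells := by tauto
        exact (hb.mapsTo haν : g a < ν.card).le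

theorem extendTableau_bijective {μ : YoungDiagram} (hμ : μ.card ≠ 0) :
    Function.Bijective (extendTableau μ) := by
  classical
  constructor
  · rintro ⟨⟨ν, hν⟩, ⟨g, h0, hb, hm⟩⟩ ⟨⟨ν', hν'⟩, ⟨g', h0', hb', hm'⟩⟩ h
    have hfun : ∀ c, (if c ∈ μ.cells ∧ c ∉ ν.cells then ν.card else g c) =
        (if c ∈ μ.cells ∧ c ∉ ν'.cells then ν'.card else g' c) := fun c =>
      congrFun (congrArg Subtype.val h) c
    obtain ⟨hle, hcard⟩ := mem_lower.1 hν
    obtain ⟨hle', hcard'⟩ := mem_lower.1 hν'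
    have hcc : ν.card = ν'.card := by omega
    have hlt : ∀ c ∈ ν.cells, g c < ν.card := fun c hc => hb.mapsTo hc
    have hlt' : ∀ c ∈ ν'.cells, g' c < ν'.card := fun c hc => hb'.mapsTo hc
    have hνν : ν = ν' := by
      apply YoungDiagram.ext
      ext c
      constructor
      · intro hc
        by_contra hc'
        have := hfun c
        rw [if_neg (by tauto), if_pos ⟨YoungDiagram.cells_subset_iff.2 hle hc, hc'⟩] at this
        have := hlt c hc
        omega
      · intro hc
        by_contra hc'
        have := hfun c
        rw [if_pos ⟨YoungDiagram.cells_subset_iff.2 hle' hc, hc'⟩, if_neg (by tauto)] at this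
        have := hlt' c hc
        omega
    subst hνν
    have hgg : g = g' := by
      funext c
      by_cases hc : c ∈ ν.cells
      · have := hfun c
        rwa [if_neg (by tauto), if_neg (by tauto)] at this
      · rw [h0 c hc, h0' c hc]
    subst hgg
    rfl
  · rintro ⟨g, h0, hb, hm⟩
    obtain ⟨c, hc, hgc⟩ := hb.surjOn (show μ.card - 1 ∈ Set.Iio μ.card by
      rw [Set.mem_Iio]; omega)
    have hc' : c ∈ μ.cells := hc
    have hlt : ∀ d ∈ μ.cells, g d < μ.card := fun d hd => hb.mapsTo hd
    let ν : YoungDiagram :=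
      { cells := μ.cells.erase c
        isLowerSet := by
          intro b a hab hb'
          simp only [Finset.coe_erase, Set.mem_sdiff, Finset.mem_coe,
            Set.mem_singleton_iff] at hb' ⊢
          have ha : a ∈ μ.cells := μ.isLowerSet hab hb'.1
          refine ⟨ha, ?_⟩
          rintro rfl
          have h1 := hm hc hb'.1 hab
          have h2 := hlt b hb'.1
          exact hb'.2 (hb.injOn hb'.1 hc (by omega)) }
    have hcard : μ.card = ν.card + 1 := (Finset.card_erase_add_one hc').symm
    have hν : ν ∈ lower μ :=
      mem_lower.2 ⟨YoungDiagram.cells_subset_iff.1 (Finset.erase_subset _ _), hcard⟩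
    have hmem : ∀ d, d ∈ ν.cells ↔ d ≠ c ∧ d ∈ μ.cells := fun d => Finset.mem_erase
    have hg : Function.update g c 0 ∈ tableaux ν := by
      have hup : ∀ d ∈ ν.cells, Function.update g c 0 d = g d := fun d hd =>
        Function.update_of_ne ((hmem d).1 hd).1 _ _
      refine ⟨?_, ⟨?_, ?_, ?_⟩, ?_⟩
      · intro d hd
        by_cases hdc : d = c
        · simp [hdc]
        · rw [Function.update_of_ne hdc]
          exact h0 d fun h => hd ((hmem d).2 ⟨hdc, h⟩)
      · intro d hd
        rw [hup d hd, Set.mem_Iio]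
        obtain ⟨hdc, hdμ⟩ := (hmem d).1 hd
        have h1 := hlt d hdμ
        have h2 : g d ≠ g c := fun h => hdc (hb.injOn hdμ hc h)
        omega
      · intro d hd e he h
        rw [hup d hd, hup e he] at h
        exact hb.injOn ((hmem d).1 hd).2 ((hmem e).1 he).2 h
      · intro k hk
        have hk' : k < ν.card := hk
        obtain ⟨d, hd, rfl⟩ := hb.surjOn (show k ∈ Set.Iio μ.card by
          rw [Set.mem_Iio]; omega)
        have hdν : d ∈ ν.cells := (hmem d).2 ⟨by rintro rfl; omega, hd⟩
        exact ⟨d, hdν, hup d hdν⟩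
      · intro a ha b hb' hab
        rw [hup a ha, hup b hb']
        exact hm ((hmem a).1 ha).2 ((hmem b).1 hb').2 hab
    refine ⟨⟨⟨ν, hν⟩, ⟨_, hg⟩⟩, ?_⟩
    apply Subtype.ext
    funext d
    change (if d ∈ μ.cells ∧ d ∉ ν.cells then ν.card else Function.update g c 0 d) = g d
    by_cases hdc : d = c
    · subst hdc
      rw [if_pos ⟨hc', by simp [hmem]⟩]
      omega
    · rw [if_neg (by rw [hmem]; tauto), Function.update_of_ne hdc]

/-- The branching rule: removing the box with the largest label. -/
theorem youngDim_eq_sum_lower {μ : YoungDiagram} (hμ : μ.card ≠ 0) :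
    youngDim μ = ∑ ν ∈ lower μ, youngDim ν := by
  rw [youngDim_eq, ← Nat.card_eq_of_bijective _ (extendTableau_bijective hμ), Nat.card_sigma,
    Finset.sum_coe_sort (lower μ) fun ν => Nat.card (tableaux ν)]
  exact Finset.sum_congr rfl fun ν _ => (youngDim_eq ν).symm

theorem youngDim_pos (ν : YoungDiagram) : 0 < youngDim ν := by
  induction h : ν.card generalizing ν with
  | zero =>
    rw [youngDim_eq]
    have h0 : ν.cells = ∅ := Finset.card_eq_zero.1 h
    have : Nonempty (tableaux ν) :=
      ⟨⟨fun _ => 0, fun _ _ => rfl, by simp [h0, h], by simp [h0, MonotoneOn]⟩⟩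
    exact Nat.card_pos
  | succ n ih =>
    rw [youngDim_eq_sum_lower (by omega)]
    refine Finset.sum_pos (fun κ hκ => ih κ ?_) (lower_nonempty (by omega))
    have := (mem_lower.1 hκ).2
    omega

theorem card_sup_add_card_inf (ν κ : YoungDiagram) :
    (ν ⊔ κ).card + (ν ⊓ κ).card = ν.card + κ.card :=
  Finset.card_union_add_card_inter ν.cells κ.cells

theorem eq_of_le_of_card_le {ν μ : YoungDiagram} (h : ν ≤ μ) (hc : μ.card ≤ ν.card) : ν = μ :=
  YoungDiagram.ext (Finset.eq_of_subset_of_card_le (YoungDiagram.cells_subset_iff.2 h) hc)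

theorem card_mono_young {ν μ : YoungDiagram} (h : ν ≤ μ) : ν.card ≤ μ.card :=
  Finset.card_le_card (YoungDiagram.cells_subset_iff.2 h)

/-- Distinct diagrams `ν`, `κ` of equal size have a common upper neighbour iff they have a common
lower one; these are then `ν ⊔ κ` and `ν ⊓ κ`. -/
theorem sum_upper_lower_ne (ν : YoungDiagram) (f : YoungDiagram → ℕ) [DecidableEq YoungDiagram] :
    ∑ μ ∈ upper ν, ∑ κ ∈ (lower μ).erase ν, f κ = ∑ ρ ∈ lower ν, ∑ κ ∈ (upper ρ).erase ν, f κ := by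
  rw [Finset.sum_sigma', Finset.sum_sigma']
  have key1 : ∀ μ κ, μ ∈ upper ν → κ ∈ (lower μ).erase ν →
      ν ⊔ κ = μ ∧ ν ⊓ κ ∈ lower ν ∧ κ ∈ (upper (ν ⊓ κ)).erase ν := by
    intro μ κ hμ hκ
    obtain ⟨hne, hκ⟩ := Finset.mem_erase.1 hκ
    obtain ⟨h1, h2⟩ := mem_upper.1 hμ
    obtain ⟨h3, h4⟩ := mem_lower.1 hκ
    have hsup : ν ⊔ κ = μ := by
      refine eq_of_le_of_card_le (sup_le h1 h3) ?_
      by_contra hlt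
      have h5 : ν = ν ⊔ κ := eq_of_le_of_card_le le_sup_left (by omega)
      exact hne (eq_of_le_of_card_le (h5 ▸ le_sup_right) (by omega))
    have hc := card_sup_add_card_inf ν κ
    rw [hsup] at hc
    exact ⟨hsup, mem_lower.2 ⟨inf_le_left, by omega⟩,
      Finset.mem_erase.2 ⟨hne, mem_upper.2 ⟨inf_le_right, by omega⟩⟩⟩
  have key2 : ∀ ρ κ, ρ ∈ lower ν → κ ∈ (upper ρ).erase ν →
      ν ⊓ κ = ρ ∧ ν ⊔ κ ∈ upper ν ∧ κ ∈ (lower (ν ⊔ κ)).erase ν := by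
    intro ρ κ hρ hκ
    obtain ⟨hne, hκ⟩ := Finset.mem_erase.1 hκ
    obtain ⟨h1, h2⟩ := mem_lower.1 hρ
    obtain ⟨h3, h4⟩ := mem_upper.1 hκ
    have hinf : ρ = ν ⊓ κ := by
      refine eq_of_le_of_card_le (le_inf h1 h3) ?_
      by_contra hlt
      have hm := card_mono_young (inf_le_left : ν ⊓ κ ≤ ν)
      have h5 : ν ⊓ κ = ν := eq_of_le_of_card_le inf_le_left (by omega)
      exact hne (eq_of_le_of_card_le (inf_eq_left.1 h5) (by omega)).symm
    have hc := card_sup_add_card_inf ν κ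
    rw [← hinf] at hc
    exact ⟨hinf.symm, mem_upper.2 ⟨le_sup_left, by omega⟩,
      Finset.mem_erase.2 ⟨hne, mem_lower.2 ⟨le_sup_right, by omega⟩⟩⟩
  refine Finset.sum_bij' (fun p _ => ⟨ν ⊓ p.2, p.2⟩) (fun p _ => ⟨ν ⊔ p.2, p.2⟩) ?_ ?_ ?_ ?_ ?_
  · rintro ⟨μ, κ⟩ h
    obtain ⟨h1, h2⟩ := Finset.mem_sigma.1 h
    exact Finset.mem_sigma.2 (key1 μ κ h1 h2).2
  · rintro ⟨ρ, κ⟩ h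
    obtain ⟨h1, h2⟩ := Finset.mem_sigma.1 h
    exact Finset.mem_sigma.2 (key2 ρ κ h1 h2).2
  · rintro ⟨μ, κ⟩ h
    obtain ⟨h1, h2⟩ := Finset.mem_sigma.1 h
    simp [(key1 μ κ h1 h2).1]
  · rintro ⟨ρ, κ⟩ h
    obtain ⟨h1, h2⟩ := Finset.mem_sigma.1 h
    simp [(key2 ρ κ h1 h2).1]
  · intros
    rfl

/-- The dual branching rule. It follows from `youngDim_eq_sum_lower` by induction, since the up and
down operators of the Young graph have commutator the identity. -/
theorem sum_upper_youngDim (ν : YoungDiagram) :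
    ∑ μ ∈ upper ν, youngDim μ = (ν.card + 1) * youngDim ν := by
  classical
  induction h : ν.card generalizing ν with
  | zero =>
    have hl : lower ν = ∅ := by
      rw [Finset.eq_empty_iff_forall_notMem]
      intro κ hκ
      have := (mem_lower.1 hκ).2
      omega
    have h1 : ∑ μ ∈ upper ν, youngDim μ =
        ∑ μ ∈ upper ν, (youngDim ν + ∑ κ ∈ (lower μ).erase ν, youngDim κ) := by
      refine Finset.sum_congr rfl fun μ hμ => ?_
      rw [youngDim_eq_sum_lower (by have := (mem_upper.1 hμ).2; omega),
        Finset.add_sum_erase _ _ (mem_upper_iff_mem_lower.1 hμ)]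
    rw [h1, Finset.sum_add_distrib, sum_upper_lower_ne, hl, Finset.sum_const, card_upper, hl]
    simp
  | succ n ih =>
    have h1 : ∑ μ ∈ upper ν, youngDim μ =
        ∑ μ ∈ upper ν, (youngDim ν + ∑ κ ∈ (lower μ).erase ν, youngDim κ) := by
      refine Finset.sum_congr rfl fun μ hμ => ?_
      rw [youngDim_eq_sum_lower (by have := (mem_upper.1 hμ).2; omega),
        Finset.add_sum_erase _ _ (mem_upper_iff_mem_lower.1 hμ)]
    -- the left side sums `youngDim` over all down-up moves from `ν`; the diagonal moves give the
    -- first term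
    have h2 : (lower ν).card * youngDim ν + ∑ ρ ∈ lower ν, ∑ κ ∈ (upper ρ).erase ν, youngDim κ
        = (n + 1) * youngDim ν := by
      rw [← smul_eq_mul, ← Finset.sum_const, ← Finset.sum_add_distrib,
        youngDim_eq_sum_lower (μ := ν) (by omega), Finset.mul_sum]
      refine Finset.sum_congr rfl fun ρ hρ => ?_
      rw [← youngDim_eq_sum_lower (μ := ν) (by omega),
        Finset.add_sum_erase _ _ (mem_upper_iff_mem_lower.2 hρ),
        ih ρ (by have := (mem_lower.1 hρ).2; omega)]
    rw [h1, Finset.sum_add_distrib, sum_upper_lower_ne, Finset.sum_const, card_upper, smul_eq_mul]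
    linarith

/-! ### One step of the Res-Ind chain -/

theorem Irr.dim_ne_zero {T : Type*} [Group T] (ζ : Irr T) : ζ.dim ≠ 0 := by
  induction ζ using Quotient.inductionOn with
  | h ρ =>
    intro h
    change ρ.dim = 0 at h
    have := ρ.irreducible
    have hsub : Subsingleton (Fin ρ.dim → ℂ) := by rw [h]; infer_instance
    obtain ⟨x, hx⟩ := exists_ne (⊥ : Subrepresentation ρ.rep)
    apply hx
    ext v
    have hv : v = 0 := Subsingleton.elim _ _
    subst hv
    simp [zero_mem]

/-- The contribution of the entry `κ` at `ζ` to the dimension of a multiple diagram. -/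
def entryWeight {T : Type*} [Group T] (ζ : Irr T) (κ : YoungDiagram) : ℝ :=
  (ζ.dim : ℝ) ^ κ.card * youngDim κ / κ.card.factorial

theorem entryWeight_pos {T : Type*} [Group T] (ζ : Irr T) (κ : YoungDiagram) :
    0 < entryWeight ζ κ := by
  have h1 : (0 : ℝ) < ζ.dim := Nat.cast_pos.2 (Nat.pos_of_ne_zero ζ.dim_ne_zero)
  have h2 : (0 : ℝ) < youngDim κ := Nat.cast_pos.2 (youngDim_pos κ)
  have h3 : (0 : ℝ) < κ.card.factorial := Nat.cast_pos.2 κ.card.factorial_pos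
  unfold entryWeight
  positivity

section OneStep

variable {T : Type*} [Group T] [Finite T]

theorem dim_eq_prod {n : ℕ} (l : MultiDiagram T n) :
    l.dim = n.factorial * ∏ ζ, entryWeight ζ (l.1 ζ) := by
  simp only [MultiDiagram.dim, MultiDiagram.entry, entryWeight, Finset.prod_div_distrib]
  ring

theorem dim_pos {n : ℕ} (l : MultiDiagram T n) : 0 < l.dim := by
  rw [dim_eq_prod]
  have h3 : (0 : ℝ) < n.factorial := Nat.cast_pos.2 n.factorial_pos
  exact mul_pos h3 (Finset.prod_pos fun ζ _ => entryWeight_pos ζ _)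

open Classical in
theorem prod_entryWeight_update (l : Irr T → YoungDiagram) (ζ : Irr T) (κ : YoungDiagram) :
    ∏ η, entryWeight η (Function.update l ζ κ η) =
      entryWeight ζ κ * ∏ η ∈ Finset.univ.erase ζ, entryWeight η (l η) := by
  rw [← Finset.mul_prod_erase _ _ (Finset.mem_univ ζ), Function.update_self]
  congr 1
  refine Finset.prod_congr rfl fun η hη => ?_
  rw [Function.update_of_ne (Finset.ne_of_mem_erase hη)]

open Classical in
theorem sum_card_update (l : Irr T → YoungDiagram) (ζ : Irr T) (κ : YoungDiagram) :
    ∑ η, (Function.update l ζ κ η).card + (l ζ).card = ∑ η, (l η).card + κ.card := by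
  rw [← Finset.add_sum_erase _ _ (Finset.mem_univ ζ), Function.update_self,
    ← Finset.add_sum_erase (a := ζ) _ (fun η => (l η).card) (Finset.mem_univ ζ)]
  have : ∑ η ∈ Finset.univ.erase ζ, (Function.update l ζ κ η).card =
      ∑ η ∈ Finset.univ.erase ζ, (l η).card := by
    refine Finset.sum_congr rfl fun η hη => ?_
    rw [Function.update_of_ne (Finset.ne_of_mem_erase hη)]
  omega

open Classical in
theorem sum_addsBoxAt_left {m n : ℕ} (hmn : n = m + 1) (ζ : Irr T) (l : MultiDiagram T n)
    (w : (Irr T → YoungDiagram) → ℝ) :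
    ∑ ν : MultiDiagram T m, (if AddsBoxAt ζ ν l then w ν.1 else 0) =
      ∑ κ ∈ lower (l.1 ζ), w (Function.update l.1 ζ κ) := by
  rw [← Finset.sum_filter]
  have hupd : ∀ ν : MultiDiagram T m, AddsBoxAt ζ ν l → ν.1 = Function.update l.1 ζ (ν.1 ζ) := by
    intro ν h
    funext η
    by_cases hη : η = ζ
    · subst hη; simp
    · rw [Function.update_of_ne hη]
      exact (h.2.2 η hη).symm
  refine Finset.sum_bij (fun ν _ => ν.1 ζ) ?_ ?_ ?_ ?_
  · intro ν hν
    have h := (Finset.mem_filter.1 hν).2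
    exact mem_lower.2 ⟨h.1, h.2.1⟩
  · intro ν hν ν' hν' h
    apply Subtype.ext
    rw [hupd ν (Finset.mem_filter.1 hν).2, hupd ν' (Finset.mem_filter.1 hν').2]
    rw [h]
  · intro κ hκ
    obtain ⟨h1, h2⟩ := mem_lower.1 hκ
    refine ⟨⟨Function.update l.1 ζ κ, ?_⟩, ?_, ?_⟩
    · have := sum_card_update l.1 ζ κ
      have := l.2
      omega
    · refine Finset.mem_filter.2 ⟨Finset.mem_univ _, ?_, ?_, ?_⟩
      · simpa [MultiDiagram.entry] using h1
      · simpa [MultiDiagram.entry] using h2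
      · intro η hη
        simp [MultiDiagram.entry, hη]
    · simp
  · intro ν hν
    exact congrArg w (hupd ν (Finset.mem_filter.1 hν).2)

open Classical in
theorem sum_addsBoxAt_right {m n : ℕ} (hmn : n = m + 1) (ζ : Irr T) (ν : MultiDiagram T m)
    (w : (Irr T → YoungDiagram) → ℝ) :
    ∑ μ : MultiDiagram T n, (if AddsBoxAt ζ ν μ then w μ.1 else 0) =
      ∑ κ ∈ upper (ν.1 ζ), w (Function.update ν.1 ζ κ) := by
  rw [← Finset.sum_filter]
  have hupd : ∀ μ : MultiDiagram T n, AddsBoxAt ζ ν μ → μ.1 = Function.update ν.1 ζ (μ.1 ζ) := by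
    intro μ h
    funext η
    by_cases hη : η = ζ
    · subst hη; simp
    · rw [Function.update_of_ne hη]
      exact h.2.2 η hη
  refine Finset.sum_bij (fun μ _ => μ.1 ζ) ?_ ?_ ?_ ?_
  · intro μ hμ
    have h := (Finset.mem_filter.1 hμ).2
    exact mem_upper.2 ⟨h.1, h.2.1⟩
  · intro μ hμ μ' hμ' h
    apply Subtype.ext
    rw [hupd μ (Finset.mem_filter.1 hμ).2, hupd μ' (Finset.mem_filter.1 hμ').2]
    rw [h]
  · intro κ hκ
    obtain ⟨h1, h2⟩ := mem_upper.1 hκ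
    refine ⟨⟨Function.update ν.1 ζ κ, ?_⟩, ?_, ?_⟩
    · have := sum_card_update ν.1 ζ κ
      have := ν.2
      omega
    · refine Finset.mem_filter.2 ⟨Finset.mem_univ _, ?_, ?_, ?_⟩
      · simpa [MultiDiagram.entry] using h1
      · simpa [MultiDiagram.entry] using h2
      · intro η hη
        simp [MultiDiagram.entry, hη]
    · simp
  · intro μ hμ
    exact congrArg w (hupd μ (Finset.mem_filter.1 hμ).2)

open Classical in
/-- The restriction step removes a box at the entry `ζ` with probability `|l^ζ| / n`. -/
theorem sum_dim_of_addsBoxAt_left {m n : ℕ} (hmn : n = m + 1) (ζ : Irr T) (l : MultiDiagram T n) :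
    ∑ ν : MultiDiagram T m, (if AddsBoxAt ζ ν l then (ζ.dim : ℝ) * ν.dim else 0) =
      (l.1 ζ).card / n * l.dim := by
  have hn : (n : ℝ) ≠ 0 := by rw [hmn]; positivity
  simp only [dim_eq_prod]
  rw [sum_addsBoxAt_left hmn ζ l
    (fun f => (ζ.dim : ℝ) * (m.factorial * ∏ η, entryWeight η (f η)))]
  have hl : ∏ η, entryWeight η (l.1 η) = entryWeight ζ (l.1 ζ) *
      ∏ η ∈ Finset.univ.erase ζ, entryWeight η (l.1 η) :=
    (Finset.mul_prod_erase _ _ (Finset.mem_univ ζ)).symm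
  simp only [prod_entryWeight_update, hl]
  set R := ∏ η ∈ Finset.univ.erase ζ, entryWeight η (l.1 η)
  by_cases h0 : (l.1 ζ).card = 0
  · rw [h0]
    have : lower (l.1 ζ) = ∅ := by
      rw [Finset.eq_empty_iff_forall_notMem]
      intro κ hκ
      have := (mem_lower.1 hκ).2
      omega
    simp [this]
  · obtain ⟨k, hk⟩ := Nat.exists_eq_succ_of_ne_zero h0
    have hd : (youngDim (l.1 ζ) : ℝ) = ∑ κ ∈ lower (l.1 ζ), (youngDim κ : ℝ) := by
      exact_mod_cast youngDim_eq_sum_lower h0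
    have hn1 : (n.factorial : ℝ) = (m + 1) * m.factorial := by
      rw [hmn, Nat.factorial_succ]; push_cast; ring
    have hn2 : (n : ℝ) = m + 1 := by rw [hmn]; push_cast; ring
    have hk' : (k.factorial : ℝ) ≠ 0 := by exact_mod_cast k.factorial_ne_zero
    have hterm : ∀ κ ∈ lower (l.1 ζ), (ζ.dim : ℝ) * (m.factorial * (entryWeight ζ κ * R)) =
        (m.factorial * R * (ζ.dim : ℝ) ^ (k + 1) / k.factorial) * youngDim κ := by
      intro κ hκ
      have hκc : κ.card = k := by have := (mem_lower.1 hκ).2; omega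
      rw [entryWeight, hκc]
      ring
    rw [Finset.sum_congr rfl hterm, ← Finset.mul_sum, ← hd, entryWeight, hk,
      Nat.succ_eq_add_one, Nat.factorial_succ k, hn1, hn2]
    push_cast
    have h1 : (k : ℝ) + 1 ≠ 0 := by positivity
    have h2 : (m : ℝ) + 1 ≠ 0 := by positivity
    field_simp

open Classical in
/-- The induction step adds a box at the entry `ζ` with probability `(dim ζ)² / |T|`. -/
theorem sum_dim_of_addsBoxAt_right {m n : ℕ} (hmn : n = m + 1) (ζ : Irr T)
    (ν : MultiDiagram T m) :
    ∑ μ : MultiDiagram T n, (if AddsBoxAt ζ ν μ then (ζ.dim : ℝ) * μ.dim else 0) =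
      (ζ.dim : ℝ) ^ 2 * n * ν.dim := by
  simp only [dim_eq_prod]
  rw [sum_addsBoxAt_right hmn ζ ν
    (fun f => (ζ.dim : ℝ) * (n.factorial * ∏ η, entryWeight η (f η)))]
  have hl : ∏ η, entryWeight η (ν.1 η) = entryWeight ζ (ν.1 ζ) *
      ∏ η ∈ Finset.univ.erase ζ, entryWeight η (ν.1 η) :=
    (Finset.mul_prod_erase _ _ (Finset.mem_univ ζ)).symm
  simp only [prod_entryWeight_update, hl]
  set R := ∏ η ∈ Finset.univ.erase ζ, entryWeight η (ν.1 η)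
  have hd : ∑ κ ∈ upper (ν.1 ζ), (youngDim κ : ℝ) = ((ν.1 ζ).card + 1) * youngDim (ν.1 ζ) := by
    exact_mod_cast sum_upper_youngDim (ν.1 ζ)
  have hk' : ((ν.1 ζ).card.factorial : ℝ) ≠ 0 := by exact_mod_cast (ν.1 ζ).card.factorial_ne_zero
  have hterm : ∀ κ ∈ upper (ν.1 ζ), (ζ.dim : ℝ) * (n.factorial * (entryWeight ζ κ * R)) =
      (n.factorial * R * (ζ.dim : ℝ) ^ ((ν.1 ζ).card + 2) / ((ν.1 ζ).card + 1).factorial) *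
        youngDim κ := by
    intro κ hκ
    rw [entryWeight, (mem_upper.1 hκ).2]
    ring
  rw [Finset.sum_congr rfl hterm, ← Finset.mul_sum, hd, entryWeight, hmn, Nat.factorial_succ,
    Nat.factorial_succ]
  push_cast
  have h1 : ((ν.1 ζ).card : ℝ) + 1 ≠ 0 := by positivity
  field_simp
  ring

/-- Averages over the restriction step of a function that depends only on the entry of the removed
box. -/
theorem sum_down_mul {n : ℕ} (hn : 1 ≤ n) (l : MultiDiagram T n) (f : MultiDiagram T (n - 1) → ℝ)
    (g : Irr T → ℝ) (hfg : ∀ η ν, AddsBoxAt η ν l → f ν = g η) :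
    ∑ ν, down l ν * f ν = ∑ η, ((l.1 η).card : ℝ) / n * g η := by
  classical
  have hl := (dim_pos l).ne'
  have h1 : ∀ ν, down l ν * f ν =
      ∑ η, (if AddsBoxAt η ν l then (η.dim : ℝ) * ν.dim else 0) * (g η / l.dim) := by
    intro ν
    simp only [down, branchMult, Finset.sum_mul, Finset.sum_div]
    refine Finset.sum_congr rfl fun η _ => ?_
    split_ifs with h
    · rw [hfg η ν h]; ring
    · simp
  rw [Finset.sum_congr rfl fun ν _ => h1 ν, Finset.sum_comm]
  refine Finset.sum_congr rfl fun η _ => ?_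
  rw [← Finset.sum_mul, sum_dim_of_addsBoxAt_left (by omega) η l]
  field_simp

/-- Averages over the induction step of a function that depends only on the entry of the added
box. -/
theorem sum_up_mul {n : ℕ} (hn : 1 ≤ n) (ν : MultiDiagram T (n - 1)) (f : MultiDiagram T n → ℝ)
    (g : Irr T → ℝ) (hfg : ∀ η μ, AddsBoxAt η ν μ → f μ = g η) :
    ∑ μ, up ν μ * f μ = ∑ η, plancherel η * g η := by
  classical
  have hν := (dim_pos ν).ne'
  have hn' : (n : ℝ) ≠ 0 := by positivity
  have hT : (Nat.card T : ℝ) ≠ 0 := by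
    exact_mod_cast Nat.card_pos.ne'
  have h1 : ∀ μ, up ν μ * f μ =
      ∑ η, (if AddsBoxAt η ν μ then (η.dim : ℝ) * μ.dim else 0) *
        (g η / (n * Nat.card T * ν.dim)) := by
    intro μ
    simp only [up, branchMult, Finset.sum_mul, Finset.sum_div]
    refine Finset.sum_congr rfl fun η _ => ?_
    split_ifs with h
    · rw [hfg η μ h]; ring
    · simp
  rw [Finset.sum_congr rfl fun μ _ => h1 μ, Finset.sum_comm]
  refine Finset.sum_congr rfl fun η _ => ?_
  rw [← Finset.sum_mul, sum_dim_of_addsBoxAt_right (by omega) η ν, plancherel]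
  field_simp

theorem sum_card_div {n : ℕ} (hn : 1 ≤ n) (l : MultiDiagram T n) :
    ∑ η, ((l.1 η).card : ℝ) / n = 1 := by
  have hn' : (n : ℝ) ≠ 0 := by positivity
  rw [← Finset.sum_div, ← Nat.cast_sum, l.2, div_self hn']

theorem sum_resInd {n : ℕ} (hn : 1 ≤ n) (l : MultiDiagram T n) :
    ∑ μ, resInd T n l μ = ∑ η : Irr T, plancherel η := by
  have h : ∀ ν : MultiDiagram T (n - 1), ∑ μ, up ν μ = ∑ η : Irr T, plancherel η := by
    intro ν
    simpa using sum_up_mul hn ν (fun _ => 1) (fun _ => 1) (fun _ _ _ => rfl)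
  simp only [resInd]
  rw [Finset.sum_comm]
  simp only [← Finset.mul_sum, h]
  rw [sum_down_mul hn l _ (fun _ => ∑ η : Irr T, plancherel η) (fun _ _ _ => rfl),
    ← Finset.sum_mul, sum_card_div hn, one_mul]

/-- The function `l ↦ |l^ζ|` is, up to a constant, an eigenfunction of the transition matrix with
eigenvalue `1 - 1/n`. -/
theorem sum_resInd_mul_card {n : ℕ} (hn : 1 ≤ n) (hc : ∑ η : Irr T, plancherel η = 1)
    (ζ : Irr T) (l : MultiDiagram T n) :
    ∑ μ, resInd T n l μ * ((μ.1 ζ).card : ℝ) =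
      (1 - 1 / (n : ℝ)) * (l.1 ζ).card + plancherel ζ := by
  classical
  have hcard : ∀ {a b : ℕ} (η : Irr T) (ν : MultiDiagram T a) (μ : MultiDiagram T b),
      AddsBoxAt η ν μ → ((μ.1 ζ).card : ℝ) = (ν.1 ζ).card + if η = ζ then 1 else 0 := by
    intro a b η ν μ h
    split_ifs with he
    · subst he
      exact_mod_cast h.2.1
    · have : μ.1 ζ = ν.1 ζ := h.2.2 ζ (Ne.symm he)
      rw [this, add_zero]
  have hup : ∀ ν : MultiDiagram T (n - 1), ∑ μ, up ν μ * ((μ.1 ζ).card : ℝ) =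
      (ν.1 ζ).card + plancherel ζ := by
    intro ν
    rw [sum_up_mul hn ν _ (fun η => ((ν.1 ζ).card : ℝ) + if η = ζ then 1 else 0)
      (fun η μ h => hcard η ν μ h)]
    simp only [mul_add, Finset.sum_add_distrib, ← Finset.sum_mul, hc]
    simp
  simp only [resInd, Finset.sum_mul]
  rw [Finset.sum_comm]
  simp only [mul_assoc, ← Finset.mul_sum, hup]
  rw [sum_down_mul hn l _ (fun η => ((l.1 ζ).card : ℝ) - (if η = ζ then 1 else 0) + plancherel ζ)
    (fun η ν h => by rw [hcard η ν l h]; ring)]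
  simp only [mul_add, mul_sub, Finset.sum_add_distrib, Finset.sum_sub_distrib, ← Finset.sum_mul,
    sum_card_div hn]
  simp
  ring

end OneStep

/-! ### Convolution powers and the coefficient `a(1, n, s)` -/

instance isProbabilityMeasure_convPow (ψ : Measure ℝ) [IsProbabilityMeasure ψ] (j : ℕ) :
    IsProbabilityMeasure (convPow ψ j) := by
  induction j with
  | zero => exact inferInstanceAs (IsProbabilityMeasure (Measure.dirac 0))
  | succ j ih => exact inferInstanceAs (IsProbabilityMeasure ((convPow ψ j).conv ψ))

theorem conv_apply {μ ν : Measure ℝ} [SFinite μ] [SFinite ν] {A : Set ℝ} (hA : MeasurableSet A) :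
    (μ.conv ν) A = ∫⁻ u, ν {y | u + y ∈ A} ∂μ := by
  rw [Measure.conv, Measure.map_apply (by fun_prop) hA,
    Measure.prod_apply (measurable_add hA)]
  rfl

/-- The distribution function of the `j`-fold convolution power of `ψ`. -/
def convCdf (ψ : Measure ℝ) (j : ℕ) (s : ℝ) : ℝ := (convPow ψ j).real (Set.Iic s)

theorem convCdf_zero {ψ : Measure ℝ} {s : ℝ} (hs : 0 ≤ s) : convCdf ψ 0 s = 1 := by
  simp [convCdf, convPow, Measure.real, hs]

theorem convCdf_nonneg {ψ : Measure ℝ} (j : ℕ) (s : ℝ) : 0 ≤ convCdf ψ j s := measureReal_nonneg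

section PauseCoeff

variable {ψ : Measure ℝ} [IsProbabilityMeasure ψ]

theorem convPow_Iio (hψ : ψ (Set.Iic 0) = 0) (j : ℕ) : convPow ψ j (Set.Iio 0) = 0 := by
  induction j with
  | zero => simp [convPow]
  | succ j ih =>
    rw [convPow, conv_apply measurableSet_Iio, lintegral_eq_zero_iff']
    · have : ∀ᵐ u ∂(convPow ψ j), 0 ≤ u := by
        rw [ae_iff]
        simpa [Set.Iio] using ih
      filter_upwards [this] with u hu
      refine measure_mono_null (fun y hy => ?_) hψ
      simp only [Set.mem_ofPred_eq, Set.mem_Iio, Set.mem_Iic] at hy ⊢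
      linarith
    · exact (measurable_measure_prodMk_left (measurable_add measurableSet_Iio)).aemeasurable

theorem antitone_real_Iic_sub (s : ℝ) : Antitone fun u => ψ.real (Set.Iic (s - u)) :=
  fun _ _ h => measureReal_mono (Set.Iic_subset_Iic.2 (by linarith))

theorem integrable_real_Iic_sub (s : ℝ) (μ : Measure ℝ) [IsFiniteMeasure μ] :
    Integrable (fun u => ψ.real (Set.Iic (s - u))) μ := by
  refine Integrable.of_bound (antitone_real_Iic_sub s).measurable.aestronglyMeasurable 1
    (Eventually.of_forall fun u => ?_)
  rw [Real.norm_of_nonneg measureReal_nonneg]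
  exact measureReal_le_one

theorem convCdf_succ (j : ℕ) (s : ℝ) :
    convCdf ψ (j + 1) s = ∫ u, ψ.real (Set.Iic (s - u)) ∂(convPow ψ j) := by
  have hset : ∀ u, {y | u + y ∈ Set.Iic s} = Set.Iic (s - u) := by
    intro u
    ext y
    simp only [Set.mem_Iic, Set.mem_ofPred_eq]
    constructor <;> intro h <;> linarith
  simp only [Measure.real]
  rw [convCdf, Measure.real, convPow, conv_apply measurableSet_Iic, integral_toReal]
  · simp only [hset]
  · have := (measurable_measure_prodMk_left (ν := ψ)
      (measurable_add (measurableSet_Iic (a := s)))).aemeasurable (μ := convPow ψ j)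
    refine this.congr (Eventually.of_forall fun u => ?_)
    exact congrArg ψ (hset u)
  · exact Eventually.of_forall fun u => measure_lt_top _ _

theorem convCdf_le_one (j : ℕ) (s : ℝ) : convCdf ψ j s ≤ 1 := measureReal_le_one

/-- The weight of `j` in the coefficient `a(1, n, s)` is the probability of exactly `j` renewals
in `[0, s]`. -/
theorem setIntegral_real_Ioi_sub (hψ : ψ (Set.Iic 0) = 0) (j : ℕ) {s : ℝ} :
    ∫ u in Set.Icc 0 s, ψ.real (Set.Ioi (s - u)) ∂(convPow ψ j) =
      convCdf ψ j s - convCdf ψ (j + 1) s := by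
  have h1 : Set.Icc 0 s =ᵐ[convPow ψ j] Set.Iic s := by
    have : ∀ᵐ u ∂(convPow ψ j), 0 ≤ u := by
      rw [ae_iff]
      simpa [Set.Iio] using convPow_Iio hψ j
    filter_upwards [this] with u hu
    simp only [eq_iff_iff]
    change (0 ≤ u ∧ u ≤ s) ↔ u ≤ s
    simp [hu]
  have h2 : ∀ u, ψ.real (Set.Ioi (s - u)) = 1 - ψ.real (Set.Iic (s - u)) := by
    intro u
    rw [← Set.compl_Iic, probReal_compl_eq_one_sub measurableSet_Iic]
  rw [setIntegral_congr_set h1]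
  simp only [h2]
  rw [integral_sub (integrable_const _) (integrable_real_Iic_sub s _).integrableOn,
    convCdf_succ,
    setIntegral_eq_integral_of_forall_compl_eq_zero (f := fun u => ψ.real (Set.Iic (s - u)))]
  · simp [convCdf]
  · intro u hu
    have hu' : s < u := by simpa using hu
    have : ψ (Set.Iic (s - u)) = 0 :=
      measure_mono_null (Set.Iic_subset_Iic.2 (by linarith)) hψ
    change (ψ (Set.Iic (s - u))).toReal = 0
    rw [this, ENNReal.toReal_zero]

theorem pauseCoeff_eq_tsum (hψ : ψ (Set.Iic 0) = 0) (n : ℕ) (s : ℝ) :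
    pauseCoeff ψ 1 n s =
      ∑' j : ℕ, (1 - 1 / (n : ℝ)) ^ j * (convCdf ψ j s - convCdf ψ (j + 1) s) := by
  simp only [pauseCoeff, setIntegral_real_Ioi_sub hψ, Nat.cast_one]

theorem one_sub_inv_nonneg {n : ℕ} (hn : 1 ≤ n) : 0 ≤ 1 - 1 / (n : ℝ) := by
  have : (1 : ℝ) ≤ n := by exact_mod_cast hn
  rw [sub_nonneg, div_le_one (by linarith)]
  exact this

theorem one_sub_inv_lt_one {n : ℕ} (hn : 1 ≤ n) : 1 - 1 / (n : ℝ) < 1 := by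
  have : (0 : ℝ) < n := by exact_mod_cast hn
  have : 0 < 1 / (n : ℝ) := by positivity
  linarith

theorem summable_pow_mul_convCdf {n : ℕ} (hn : 1 ≤ n) (s : ℝ) (i : ℕ) :
    Summable fun j : ℕ => (1 - 1 / (n : ℝ)) ^ j * convCdf ψ (j + i) s := by
  have h0 := one_sub_inv_nonneg hn
  refine Summable.of_nonneg_of_le (fun j => mul_nonneg (pow_nonneg h0 j) (convCdf_nonneg _ _))
    (fun j => ?_) (summable_geometric_of_lt_one h0 (one_sub_inv_lt_one hn))
  exact mul_le_of_le_one_right (pow_nonneg h0 j) (convCdf_le_one _ _)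

/-- Summation by parts. -/
theorem pauseCoeff_eq_one_sub (hψ : ψ (Set.Iic 0) = 0) {n : ℕ} (hn : 1 ≤ n) {s : ℝ}
    (hs : 0 ≤ s) :
    pauseCoeff ψ 1 n s =
      1 - 1 / (n : ℝ) * ∑' j : ℕ, (1 - 1 / (n : ℝ)) ^ j * convCdf ψ (j + 1) s := by
  have h0 := summable_pow_mul_convCdf (ψ := ψ) hn s 0
  have h1 := summable_pow_mul_convCdf (ψ := ψ) hn s 1
  rw [pauseCoeff_eq_tsum hψ]
  simp only [mul_sub]
  simp only [add_zero] at h0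
  rw [h0.tsum_sub h1, h0.tsum_eq_zero_add, convCdf_zero hs]
  have h2 : ∀ j : ℕ, (1 - 1 / (n : ℝ)) ^ (j + 1) * convCdf ψ (j + 1) s =
      (1 - 1 / (n : ℝ)) * ((1 - 1 / (n : ℝ)) ^ j * convCdf ψ (j + 1) s) := fun j => by ring
  simp only [h2, tsum_mul_left]
  ring

/-- The sum over `j` as an integral over `x`, where `j = ⌊n x⌋`. -/
theorem integral_floor {n : ℕ} (hn : 1 ≤ n) {f : ℕ → ℝ}
    (hint : IntegrableOn (fun x : ℝ => f ⌊n * x⌋₊) (Set.Ioi 0)) :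
    ∫ x in Set.Ioi (0 : ℝ), f ⌊n * x⌋₊ = 1 / (n : ℝ) * ∑' j, f j := by
  have hn' : (0 : ℝ) < n := by exact_mod_cast hn
  have hU : (⋃ j : ℕ, Set.Ico ((j : ℝ) / n) ((j + 1 : ℝ) / n)) = Set.Ici 0 := by
    ext x
    simp only [Set.mem_iUnion, Set.mem_Ico, Set.mem_Ici, div_le_iff₀ hn', lt_div_iff₀ hn']
    constructor
    · rintro ⟨j, hj, -⟩
      have : (0 : ℝ) ≤ x * n := le_trans (Nat.cast_nonneg j) hj
      exact nonneg_of_mul_nonneg_left this hn'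
    · intro hx
      exact ⟨⌊x * n⌋₊, Nat.floor_le (by positivity), Nat.lt_floor_add_one _⟩
  have hfl : ∀ j : ℕ, ∀ x ∈ Set.Ico ((j : ℝ) / n) ((j + 1 : ℝ) / n), ⌊n * x⌋₊ = j := by
    intro j x hx
    rw [Set.mem_Ico, div_le_iff₀ hn', lt_div_iff₀ hn'] at hx
    rw [mul_comm, Nat.floor_eq_iff (le_trans (Nat.cast_nonneg j) hx.1)]
    exact hx
  rw [← integral_Ici_eq_integral_Ioi, ← hU, integral_iUnion (fun j => measurableSet_Ico),
    ← tsum_mul_left]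
  · congr 1
    funext j
    rw [setIntegral_congr_fun measurableSet_Ico (g := fun _ => f j)
      (fun x hx => by simp only [hfl j x hx])]
    simp only [integral_const, smul_eq_mul, MeasurableSet.univ, measureReal_restrict_apply,
      Set.univ_inter, Real.volume_real_Ico]
    rw [max_eq_left (by rw [← sub_div]; simp [hn'.le])]
    ring
  · intro i j hij
    refine Set.disjoint_left.2 fun x hi hj => hij ?_
    rw [← hfl i x hi, hfl j x hj]
  · rw [hU, integrableOn_Ici_iff_integrableOn_Ioi]
    exact hint

/-- If the distribution function of the `(⌊n x⌋ + 1)`-st renewal epoch converges at `s n`, then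
`a(1, n, s n)` converges. -/
theorem tendsto_pauseCoeff (hψ : ψ (Set.Iic 0) = 0) {s : ℕ → ℝ} (hs : ∀ n, 0 ≤ s n) {G : ℝ → ℝ}
    (hG : ∀ᵐ x : ℝ ∂(volume.restrict (Set.Ioi (0 : ℝ))),
      Tendsto (fun n : ℕ => convCdf ψ (⌊n * x⌋₊ + 1) (s n)) atTop (𝓝 (G x))) :
    Tendsto (fun n : ℕ => pauseCoeff ψ 1 n (s n)) atTop
      (𝓝 (1 - ∫ x in Set.Ioi (0 : ℝ), Real.exp (-x) * G x)) := by
  have hmeas : ∀ n : ℕ, Measurable fun x : ℝ =>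
      (1 - 1 / (n : ℝ)) ^ ⌊n * x⌋₊ * convCdf ψ (⌊n * x⌋₊ + 1) (s n) := by
    intro n
    have h1 : Measurable fun x : ℝ => ⌊n * x⌋₊ := Nat.measurable_floor.comp (by fun_prop)
    exact (measurable_of_countable (fun j : ℕ => (1 - 1 / (n : ℝ)) ^ j *
      convCdf ψ (j + 1) (s n))).comp h1
  have hexp : ∀ n : ℕ, 1 ≤ n → ∀ x : ℝ, 0 < x →
      (1 - 1 / (n : ℝ)) ^ ⌊n * x⌋₊ ≤ Real.exp 1 * Real.exp (-x) := by
    intro n hn x hx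
    have hn' : (1 : ℝ) ≤ n := by exact_mod_cast hn
    have hn0 : (0 : ℝ) < n := by linarith
    calc (1 - 1 / (n : ℝ)) ^ ⌊n * x⌋₊ ≤ Real.exp (-(1 / n)) ^ ⌊n * x⌋₊ := by
          gcongr
          · exact one_sub_inv_nonneg hn
          · exact Real.one_sub_le_exp_neg _
      _ = Real.exp (-(⌊n * x⌋₊ / n)) := by
          rw [← Real.exp_nat_mul]; congr 1; ring
      _ ≤ Real.exp (1 + -x) := by
          gcongr
          have h1 := Nat.lt_floor_add_one ((n : ℝ) * x)
          have h2 : x < (⌊n * x⌋₊ + 1) / n := by rw [lt_div_iff₀ hn0]; linarith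
          have h3 : ((⌊n * x⌋₊ : ℝ) + 1) / n ≤ ⌊n * x⌋₊ / n + 1 := by
            rw [add_div]
            gcongr
            rw [div_le_one hn0]
            exact hn'
          linarith
      _ = Real.exp 1 * Real.exp (-x) := Real.exp_add _ _
  have hbd : Integrable (fun x : ℝ => Real.exp 1 * Real.exp (-x))
      (volume.restrict (Set.Ioi 0)) :=
    (integrableOn_exp_neg_Ioi 0).const_mul _
  have hle : ∀ n : ℕ, 1 ≤ n → ∀ᵐ x : ℝ ∂(volume.restrict (Set.Ioi (0 : ℝ))),
      ‖(1 - 1 / (n : ℝ)) ^ ⌊n * x⌋₊ * convCdf ψ (⌊n * x⌋₊ + 1) (s n)‖ ≤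
        Real.exp 1 * Real.exp (-x) := by
    intro n hn
    filter_upwards [ae_restrict_mem measurableSet_Ioi] with x hx
    have h0 := pow_nonneg (one_sub_inv_nonneg hn) ⌊n * x⌋₊
    rw [Real.norm_of_nonneg (mul_nonneg h0 (convCdf_nonneg _ _))]
    exact (mul_le_of_le_one_right h0 (convCdf_le_one _ _)).trans (hexp n hn x hx)
  have hlim : Tendsto (fun n : ℕ => ∫ x in Set.Ioi (0 : ℝ),
      (1 - 1 / (n : ℝ)) ^ ⌊n * x⌋₊ * convCdf ψ (⌊n * x⌋₊ + 1) (s n)) atTop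
      (𝓝 (∫ x in Set.Ioi (0 : ℝ), Real.exp (-x) * G x)) := by
    refine tendsto_integral_filter_of_dominated_convergence _
      (Eventually.of_forall fun n => (hmeas n).aestronglyMeasurable) ?_ hbd ?_
    · filter_upwards [eventually_ge_atTop 1] with n hn using hle n hn
    · filter_upwards [hG, ae_restrict_mem measurableSet_Ioi] with x hx hx0
      refine Tendsto.mul ?_ hx
      have hx0' : (0 : ℝ) < x := hx0
      have h1 : Tendsto (fun n : ℕ => (⌊(n : ℝ) * x⌋₊ : ℝ) / n) atTop (𝓝 x) := by
        have := (tendsto_nat_floor_mul_div_atTop (R := ℝ) hx0'.le).comp tendsto_natCast_atTop_atTop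
        refine this.congr fun n => ?_
        simp [mul_comm]
      have h2 : Tendsto (fun n : ℕ => (1 - 1 / (n : ℝ)) ^ n) atTop (𝓝 (Real.exp (-1))) := by
        have := Real.tendsto_one_add_div_pow_exp (-1)
        refine this.congr fun n => ?_
        congr 1; ring
      have h3 := h2.rpow h1 (Or.inl (Real.exp_pos _).ne')
      rw [← Real.exp_mul, neg_one_mul] at h3
      refine h3.congr' ?_
      filter_upwards [eventually_ge_atTop 1] with n hn
      have hn0 : (n : ℝ) ≠ 0 := by positivity
      rw [← Real.rpow_natCast, ← Real.rpow_mul (one_sub_inv_nonneg hn), mul_div_cancel₀ _ hn0,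
        Real.rpow_natCast]
  refine (tendsto_const_nhds.sub hlim).congr' ?_
  filter_upwards [eventually_ge_atTop 1] with n hn
  rw [pauseCoeff_eq_one_sub hψ hn (hs n),
    ← integral_floor hn (f := fun j => (1 - 1 / (n : ℝ)) ^ j * convCdf ψ (j + 1) (s n))]
  exact hbd.mono' (hmeas n).aestronglyMeasurable (hle n hn)

end PauseCoeff

/-! ### The renewal process -/

/-- The `j`-th renewal epoch. -/
def epoch {Ω : Type*} (ε : ℕ → Ω → ℝ) (j : ℕ) (ω : Ω) : ℝ := ∑ i ∈ Finset.range j, ε i ω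

/-- The event that there are exactly `j` renewals in `[0, s]`. -/
def countEvent {Ω : Type*} (ε : ℕ → Ω → ℝ) (s : ℝ) (j : ℕ) : Set Ω :=
  {ω | epoch ε j ω ≤ s ∧ s < epoch ε (j + 1) ω}

theorem strictMono_epoch {Ω : Type*} {ε : ℕ → Ω → ℝ} {ω : Ω} (hω : ∀ j, 0 < ε j ω) :
    StrictMono fun j => epoch ε j ω :=
  strictMono_nat_of_lt_succ fun j => by
    have := hω j
    simp only [epoch, Finset.sum_range_succ]
    linarith

theorem count_eq_of_mem_countEvent {Ω : Type*} {ε : ℕ → Ω → ℝ} {ω : Ω}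
    (hω : ∀ j, 0 < ε j ω) {s : ℝ} {j : ℕ}
    (hj : ω ∈ countEvent ε s j) : count (fun j => ε j ω) s = j := by
  have hset : {k : ℕ | ∑ i ∈ Finset.range k, ε i ω ≤ s} = Set.Iic j := by
    ext k
    change epoch ε k ω ≤ s ↔ k ≤ j
    constructor
    · intro hk
      have : epoch ε k ω < epoch ε (j + 1) ω := hk.trans_lt hj.2
      exact Nat.lt_succ_iff.1 ((strictMono_epoch hω).lt_iff_lt.1 this)
    · intro hk
      exact ((strictMono_epoch hω).monotone hk).trans hj.1
  rw [count, hset, csSup_Iic]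

/-! ### The mean sizes along the chain and along the paused process -/

theorem measureReal_eq_sum_fiber {Ω α : Type*} [MeasurableSpace Ω] [MeasurableSpace α] [Fintype α]
    [MeasurableSingletonClass α] (μ : Measure Ω) [IsFiniteMeasure μ] {f : Ω → α}
    (hf : Measurable f) (A : Set Ω) : μ.real A = ∑ a, μ.real {ω | ω ∈ A ∧ f ω = a} := by
  have h := sum_measureReal_preimage_singleton (μ := μ.restrict A) (f := f) Finset.univ
    (fun a _ => hf (measurableSet_singleton a)) 
  simp only [Finset.coe_univ, Set.preimage_univ, measureReal_restrict_apply_univ] at h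
  rw [← h]
  refine Finset.sum_congr rfl fun a _ => ?_
  rw [measureReal_restrict_apply (hf (measurableSet_singleton a))]
  congr 1
  ext ω
  simp [and_comm]

section Chain

variable {T : Type*} [Group T] [Finite T] {n : ℕ} {ψ : Measure ℝ}
  {Ω : Type*} [MeasurableSpace Ω] {Pr : Measure Ω}
  {Z : ℕ → Ω → MultiDiagram T n} {ε : ℕ → Ω → ℝ}

instance : MeasurableSingletonClass (MultiDiagram T n) := ⟨fun _ => trivial⟩

theorem IsPausedChain.measurable_epoch (h : IsPausedChain ψ Pr Z ε) (j : ℕ) :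
    Measurable (epoch ε j) :=
  Finset.measurable_fun_sum _ fun i _ => h.measurable_pause i

theorem IsPausedChain.measurableSet_countEvent (h : IsPausedChain ψ Pr Z ε) (s : ℝ) (j : ℕ) :
    MeasurableSet (countEvent ε s j) :=
  (measurableSet_le (h.measurable_epoch j) measurable_const).inter
    (measurableSet_lt measurable_const (h.measurable_epoch (j + 1)))

theorem IsPausedChain.ae_pos (h : IsPausedChain ψ Pr Z ε) (hψ : ψ (Set.Iic 0) = 0) :
    ∀ᵐ ω ∂Pr, ∀ j, 0 < ε j ω := by
  rw [ae_all_iff]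
  intro j
  have : ∀ᵐ x ∂ψ, 0 < x := by
    rw [ae_iff]
    simpa [Set.Iic] using hψ
  rw [← h.law_pause j] at this
  exact ae_of_ae_map (h.measurable_pause j).aemeasurable this

theorem IsPausedChain.meanSize_zero (h : IsPausedChain ψ Pr Z ε) (hψ : ψ (Set.Iic 0) = 0)
    (ζ : Irr T) : meanSize Pr Z ε ζ 0 = ∫ ω, (((Z 0 ω).entry ζ).card : ℝ) / n ∂Pr := by
  refine integral_congr_ae ?_
  filter_upwards [h.ae_pos hψ] with ω hω
  have : ω ∈ countEvent ε 0 0 := ⟨by simp [epoch], by simpa [epoch] using hω 0⟩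
  simp only [process, count_eq_of_mem_countEvent hω this]

variable [IsProbabilityMeasure Pr]

theorem IsPausedChain.prob_pair (h : IsPausedChain ψ Pr Z ε) (k : ℕ) (z y : MultiDiagram T n) :
    Pr.real {ω | Z k ω = z ∧ Z (k + 1) ω = y} = Pr.real {ω | Z k ω = z} * resInd T n z y := by
  have hW : Measurable fun ω => fun i : Fin k => Z i ω :=
    measurable_pi_lambda _ fun i => h.measurable_chain i
  rw [measureReal_eq_sum_fiber Pr hW, measureReal_eq_sum_fiber Pr hW {ω | Z k ω = z},
    Finset.sum_mul]
  refine Finset.sum_congr rfl fun a _ => ?_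
  let x : ℕ → MultiDiagram T n := fun i =>
    if hi : i < k then a ⟨i, hi⟩ else if i = k then z else y
  have hx1 : ∀ i : Fin k, x i = a i := fun i => by simp [x]
  have hx2 : x k = z := by simp [x]
  have hx3 : x (k + 1) = y := by simp [x]
  have hpath : ∀ ω, (∀ i ≤ k, Z i ω = x i) ↔ Z k ω = z ∧ (fun i : Fin k => Z i ω) = a := by
    intro ω
    constructor
    · intro hω
      refine ⟨hx2 ▸ hω k le_rfl, funext fun i => ?_⟩
      rw [← hx1 i]
      exact hω i i.2.le
    · rintro ⟨h1, h2⟩ i hi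
      rcases hi.lt_or_eq with hi | rfl
      · have := congrFun h2 ⟨i, hi⟩
        rw [← hx1 ⟨i, hi⟩] at this
        exact this
      · rw [hx2, h1]
  have hm := h.markov k x
  rw [hx2, hx3] at hm
  convert hm using 2
  · congr 1
    ext ω
    simp only [Set.mem_ofPred_eq]
    have : (∀ i ≤ k + 1, Z i ω = x i) ↔ (∀ i ≤ k, Z i ω = x i) ∧ Z (k + 1) ω = y := by
      constructor
      · intro hω
        exact ⟨fun i hi => hω i (hi.trans (Nat.le_succ k)), hx3 ▸ hω (k + 1) le_rfl⟩
      · rintro ⟨h1, h2⟩ i hi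
        rcases Nat.le_succ_iff.1 hi with hi | rfl
        · exact h1 i hi
        · rw [hx3, h2]
    rw [this, hpath]
    tauto
  · congr 1
    ext ω
    simp only [Set.mem_ofPred_eq]
    rw [hpath]

theorem IsPausedChain.prob_succ (h : IsPausedChain ψ Pr Z ε) (k : ℕ) (y : MultiDiagram T n) :
    Pr.real {ω | Z (k + 1) ω = y} = ∑ z, Pr.real {ω | Z k ω = z} * resInd T n z y := by
  rw [measureReal_eq_sum_fiber Pr (h.measurable_chain k)]
  refine Finset.sum_congr rfl fun z _ => ?_
  rw [← h.prob_pair k z y]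
  congr 1
  ext ω
  simp [and_comm]

theorem IsPausedChain.sum_prob (h : IsPausedChain ψ Pr Z ε) (k : ℕ) :
    ∑ z, Pr.real {ω | Z k ω = z} = 1 := by
  have := measureReal_eq_sum_fiber Pr (h.measurable_chain k) Set.univ
  simpa using this.symm

/-- The squares of the dimensions add up to `|T|`: by `sum_resInd` their sum is `|T|` times each row
sum of the transition matrix, and the rows of a matrix that governs a Markov chain sum to `1`. -/
theorem IsPausedChain.sum_plancherel (hn : 1 ≤ n) (h : IsPausedChain ψ Pr Z ε) :
    ∑ η : Irr T, plancherel η = 1 := by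
  have h1 := h.sum_prob 1
  simp only [h.prob_succ 0] at h1
  rw [Finset.sum_comm] at h1
  simp only [← Finset.mul_sum, sum_resInd hn] at h1
  rw [← Finset.sum_mul, h.sum_prob 0, one_mul] at h1
  exact h1

theorem IsPausedChain.integral_chain (h : IsPausedChain ψ Pr Z ε) (k : ℕ)
    (f : MultiDiagram T n → ℝ) :
    ∫ ω, f (Z k ω) ∂Pr = ∑ z, Pr.real {ω | Z k ω = z} * f z := by
  have hZ := h.measurable_chain k
  rw [← integral_map (φ := Z k) (f := f) hZ.aemeasurable
    (measurable_of_countable f).aestronglyMeasurable]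
  have : IsProbabilityMeasure (Pr.map (Z k)) := Measure.isProbabilityMeasure_map hZ.aemeasurable
  rw [integral_fintype (Integrable.of_finite)]
  refine Finset.sum_congr rfl fun z _ => ?_
  rw [map_measureReal_apply hZ (measurableSet_singleton z), smul_eq_mul]
  rfl

theorem IsPausedChain.integral_card_succ (hn : 1 ≤ n) (h : IsPausedChain ψ Pr Z ε) (ζ : Irr T)
    (k : ℕ) :
    ∫ ω, (((Z (k + 1) ω).entry ζ).card : ℝ) / n ∂Pr =
      (1 - 1 / (n : ℝ)) * ∫ ω, (((Z k ω).entry ζ).card : ℝ) / n ∂Pr + plancherel ζ / n := by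
  have hsum : ∀ k, ∫ ω, (((Z k ω).entry ζ).card : ℝ) / n ∂Pr =
      ∑ z, Pr.real {ω | Z k ω = z} * (((z.1 ζ).card : ℝ) / n) := fun k =>
    h.integral_chain k fun z => (((z.1 ζ).card : ℝ) / n)
  rw [hsum, hsum]
  simp only [h.prob_succ k, Finset.sum_mul]
  rw [Finset.sum_comm, Finset.mul_sum]
  have hone : plancherel ζ / n = ∑ z, Pr.real {ω | Z k ω = z} * (plancherel ζ / n) := by
    rw [← Finset.sum_mul, h.sum_prob k, one_mul]
  rw [hone, ← Finset.sum_add_distrib]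
  refine Finset.sum_congr rfl fun z _ => ?_
  have := sum_resInd_mul_card hn (h.sum_plancherel hn) ζ z
  simp only [mul_assoc, ← Finset.mul_sum, ← mul_div_assoc, ← Finset.sum_div]
  rw [this]
  ring

theorem IsPausedChain.integral_card (hn : 1 ≤ n) (h : IsPausedChain ψ Pr Z ε) (ζ : Irr T)
    (k : ℕ) :
    ∫ ω, (((Z k ω).entry ζ).card : ℝ) / n ∂Pr = plancherel ζ +
      (1 - 1 / (n : ℝ)) ^ k * (∫ ω, (((Z 0 ω).entry ζ).card : ℝ) / n ∂Pr - plancherel ζ) := by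
  induction k with
  | zero => simp
  | succ k ih =>
    rw [h.integral_card_succ hn, ih, pow_succ]
    ring

theorem IsPausedChain.map_epoch (h : IsPausedChain ψ Pr Z ε) (j : ℕ) :
    Pr.map (epoch ε j) = convPow ψ j := by
  induction j with
  | zero =>
    have : epoch ε 0 = fun _ => 0 := by funext ω; simp [epoch]
    rw [this, Measure.map_const, measure_univ, one_smul]
    rfl
  | succ j ih =>
    have hind : IndepFun (epoch ε j) (ε j) Pr := by
      have := h.iIndep_pause.indepFun_sum_range_succ h.measurable_pause j
      convert this using 1
      funext ω
      simp [epoch]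
    have hadd : epoch ε (j + 1) = epoch ε j + ε j := by
      funext ω
      simp [epoch, Finset.sum_range_succ]
    have : IsProbabilityMeasure ψ := h.law_pause 0 ▸
      Measure.isProbabilityMeasure_map (h.measurable_pause 0).aemeasurable
    rw [hadd, hind.map_add_eq_map_conv_map (h.measurable_epoch j) (h.measurable_pause j), ih,
      h.law_pause j]
    rfl

theorem IsPausedChain.convCdf_eq (h : IsPausedChain ψ Pr Z ε) (j : ℕ) (s : ℝ) :
    convCdf ψ j s = Pr.real {ω | epoch ε j ω ≤ s} := by
  rw [convCdf, ← h.map_epoch j, map_measureReal_apply (h.measurable_epoch j) measurableSet_Iic]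
  rfl

/-- The distribution functions of the renewal epochs decay geometrically, as `𝔼 exp (-ε) < 1`. -/
theorem IsPausedChain.tendsto_convCdf (h : IsPausedChain ψ Pr Z ε) (hψ : ψ (Set.Iic 0) = 0)
    (s : ℝ) : Tendsto (fun j => convCdf ψ j s) atTop (𝓝 0) := by
  have : IsProbabilityMeasure ψ := h.law_pause 0 ▸
    Measure.isProbabilityMeasure_map (h.measurable_pause 0).aemeasurable
  have hpos := h.ae_pos hψ
  set q := mgf (ε 0) Pr (-1) with hq
  have hq0 : 0 ≤ q := mgf_nonneg
  have hint : ∀ X : Ω → ℝ, Measurable X → (∀ᵐ ω ∂Pr, 0 ≤ X ω) →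
      Integrable (fun ω => Real.exp (-1 * X ω)) Pr := by
    intro X hX hX0
    refine Integrable.of_bound (by fun_prop) 1 ?_
    filter_upwards [hX0] with ω hω
    rw [Real.norm_of_nonneg (Real.exp_pos _).le, Real.exp_le_one_iff]
    linarith
  have hq1 : q < 1 := by
    have hi := hint (ε 0) (h.measurable_pause 0) (hpos.mono fun ω hω => (hω 0).le)
    have h1 : 0 < ∫ ω, (1 - Real.exp (-1 * ε 0 ω)) ∂Pr := by
      rw [integral_pos_iff_support_of_nonneg_ae]
      · have : (Function.support fun ω => 1 - Real.exp (-1 * ε 0 ω)) =ᵐ[Pr] Set.univ := by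
          filter_upwards [hpos] with ω hω
          simp only [eq_iff_iff]
          change (1 - Real.exp (-1 * ε 0 ω) ≠ 0) ↔ True
          have := Real.exp_lt_one_iff.2 (show -1 * ε 0 ω < 0 by linarith [hω 0])
          simp only [iff_true]
          linarith
        rw [measure_congr this, measure_univ]
        exact one_pos
      · filter_upwards [hpos] with ω hω
        have := Real.exp_lt_one_iff.2 (show -1 * ε 0 ω < 0 by linarith [hω 0])
        simp only [Pi.zero_apply]
        linarith
      · exact (integrable_const 1).sub hi
    rw [integral_sub (integrable_const _) hi] at h1
    simp only [integral_const, probReal_univ, smul_eq_mul, mul_one] at h1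
    rw [hq, mgf]
    linarith
  have hbound : ∀ j, convCdf ψ j s ≤ Real.exp s * q ^ j := by
    intro j
    have hS : ∀ᵐ ω ∂Pr, 0 ≤ epoch ε j ω := by
      filter_upwards [hpos] with ω hω
      exact Finset.sum_nonneg fun i _ => (hω i).le
    have h1 := measure_le_le_exp_mul_mgf (μ := Pr) (X := epoch ε j) (t := -1) s (by norm_num)
      (hint _ (h.measurable_epoch j) hS)
    have h2 : mgf (epoch ε j) Pr (-1) = q ^ j := by
      have h3 := h.iIndep_pause.mgf_sum (t := -1) h.measurable_pause (Finset.range j)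
      have h4 : epoch ε j = ∑ i ∈ Finset.range j, ε i := by
        funext ω; simp [epoch]
      rw [h4, h3, Finset.prod_congr rfl (g := fun _ => q), Finset.prod_const, Finset.card_range]
      intro i _
      have : IdentDistrib (ε i) (ε 0) Pr Pr :=
        ⟨(h.measurable_pause i).aemeasurable, (h.measurable_pause 0).aemeasurable,
          by rw [h.law_pause, h.law_pause]⟩
      exact congrFun (mgf_congr_identDistrib this) (-1)
    rw [h2, neg_neg, one_mul] at h1
    rw [h.convCdf_eq]
    exact h1
  have hlim : Tendsto (fun j => Real.exp s * q ^ j) atTop (𝓝 0) := by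
    simpa using (tendsto_pow_atTop_nhds_zero_of_lt_one hq0 hq1).const_mul (Real.exp s)
  exact squeeze_zero (fun j => convCdf_nonneg _ _) hbound hlim

theorem IsPausedChain.prob_countEvent (h : IsPausedChain ψ Pr Z ε) (hψ : ψ (Set.Iic 0) = 0)
    (s : ℝ) (j : ℕ) :
    Pr.real (countEvent ε s j) = convCdf ψ j s - convCdf ψ (j + 1) s := by
  rw [h.convCdf_eq, h.convCdf_eq]
  have hsub : ({ω | epoch ε (j + 1) ω ≤ s} ∩ {ω | epoch ε j ω ≤ s} : Set Ω) =ᵐ[Pr]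
      {ω | epoch ε (j + 1) ω ≤ s} := by
    filter_upwards [h.ae_pos hψ] with ω hω
    simp only [eq_iff_iff]
    change (epoch ε (j + 1) ω ≤ s ∧ epoch ε j ω ≤ s) ↔ epoch ε (j + 1) ω ≤ s
    exact and_iff_left_of_imp fun h' => (strictMono_epoch hω (Nat.lt_succ_self j)).le.trans h'
  rw [← measureReal_congr hsub, Set.inter_comm]
  have hdiff := measureReal_inter_add_sdiff (μ := Pr) (s := {ω | epoch ε j ω ≤ s})
    (measurableSet_le (h.measurable_epoch (j + 1)) (measurable_const (a := s)))
  have hE : countEvent ε s j = {ω | epoch ε j ω ≤ s} \ {ω | epoch ε (j + 1) ω ≤ s} := by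
    ext ω
    simp [countEvent]
  rw [hE]
  linarith

theorem IsPausedChain.hasSum_prob_countEvent (h : IsPausedChain ψ Pr Z ε)
    (hψ : ψ (Set.Iic 0) = 0) {s : ℝ} (hs : 0 ≤ s) :
    HasSum (fun j => convCdf ψ j s - convCdf ψ (j + 1) s) 1 := by
  rw [hasSum_iff_tendsto_nat_of_nonneg]
  · simp only [Finset.sum_range_sub', convCdf_zero hs]
    simpa using (h.tendsto_convCdf hψ s).const_sub 1
  · intro j
    rw [← h.prob_countEvent hψ]
    exact measureReal_nonneg

/-- Almost surely the number of renewals in `[0, s]` is finite. -/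
theorem IsPausedChain.ae_mem_iUnion_countEvent (h : IsPausedChain ψ Pr Z ε)
    (hψ : ψ (Set.Iic 0) = 0) {s : ℝ} (hs : 0 ≤ s) : ∀ᵐ ω ∂Pr, ω ∈ ⋃ j, countEvent ε s j := by
  have hpos := h.ae_pos hψ
  have hnull : Pr {ω | ∀ j, epoch ε j ω ≤ s} = 0 := by
    rw [← measureReal_eq_zero_iff]
    refine le_antisymm (ge_of_tendsto' (h.tendsto_convCdf hψ s) fun j => ?_) measureReal_nonneg
    rw [h.convCdf_eq]
    exact measureReal_mono fun ω hω => hω j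
  have hex : ∀ᵐ ω ∂Pr, ∃ j, s < epoch ε j ω := by
    rw [ae_iff]
    simpa using hnull
  filter_upwards [hpos, hex] with ω hω hj
  classical
  have hfind := Nat.find_spec hj
  have h0 : Nat.find hj ≠ 0 := by
    intro h0
    rw [h0] at hfind
    simp only [epoch, Finset.range_zero, Finset.sum_empty] at hfind
    linarith
  refine Set.mem_iUnion.2 ⟨Nat.find hj - 1, ?_, ?_⟩
  · exact not_lt.1 (Nat.find_min hj (by omega))
  · rwa [Nat.sub_add_cancel (by omega)]

/-- The mean size along the paused process: conditioning on the number of renewals turns the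
geometric relaxation of the chain into the coefficient `a(1, n, s)`. -/
theorem IsPausedChain.meanSize_eq (hn : 1 ≤ n) (h : IsPausedChain ψ Pr Z ε)
    (hψ : ψ (Set.Iic 0) = 0) (ζ : Irr T) {s : ℝ} (hs : 0 ≤ s) :
    meanSize Pr Z ε ζ s = plancherel ζ + pauseCoeff ψ 1 n s *
      (∫ ω, (((Z 0 ω).entry ζ).card : ℝ) / n ∂Pr - plancherel ζ) := by
  have hprobψ : IsProbabilityMeasure ψ := h.law_pause 0 ▸
    Measure.isProbabilityMeasure_map (h.measurable_pause 0).aemeasurable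
  have hpos := h.ae_pos hψ
  have hU := h.ae_mem_iUnion_countEvent hψ hs
  have hAm := h.measurableSet_countEvent s
  let f : MultiDiagram T n → ℝ := fun l => ((l.entry ζ).card : ℝ) / n
  have hf0 : ∀ l, 0 ≤ f l := fun l => by positivity
  have hf1 : ∀ l, f l ≤ 1 := by
    intro l
    have hc : (l.entry ζ).card ≤ n := by
      calc (l.entry ζ).card ≤ ∑ η, (l.1 η).card :=
            Finset.single_le_sum (f := fun η => (l.1 η).card) (fun _ _ => Nat.zero_le _)
              (Finset.mem_univ ζ)
        _ = n := l.2
    have hn0 : (0 : ℝ) < n := by exact_mod_cast hn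
    rw [div_le_one hn0]
    exact_mod_cast hc
  have hfm : Measurable f := measurable_of_countable f
  let F : Ω → ℝ := fun ω => f (process Z ε s ω)
  have hFj : ∀ j, ∀ᵐ ω ∂Pr, ω ∈ countEvent ε s j → F ω = f (Z j ω) := by
    intro j
    filter_upwards [hpos] with ω hω hj
    simp only [F, process, count_eq_of_mem_countEvent hω hj]
  have hdisj : Pairwise (Function.onFun (AEDisjoint Pr) (countEvent ε s)) := by
    intro i j hij
    refine measure_mono_null (fun ω hω => ?_) (ae_iff.1 hpos)
    intro hω'
    exact hij ((count_eq_of_mem_countEvent hω' hω.1).symm.trans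
      (count_eq_of_mem_countEvent hω' hω.2))
  have hFint : IntegrableOn F (⋃ j, countEvent ε s j) Pr := by
    have hmeas : AEStronglyMeasurable F (Pr.restrict (⋃ j, countEvent ε s j)) := by
      rw [aestronglyMeasurable_iUnion_iff]
      intro j
      refine AEStronglyMeasurable.congr
        ((hfm.comp (h.measurable_chain j)).aestronglyMeasurable) ?_
      rw [EventuallyEq, ae_restrict_iff' (hAm j)]
      filter_upwards [hFj j] with ω hω hj
      exact (hω hj).symm
    refine Integrable.of_bound hmeas 1 (Eventually.of_forall fun ω => ?_)
    rw [Real.norm_of_nonneg (hf0 _)]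
    exact hf1 _
  have hsum := hasSum_integral_iUnion_ae (fun j => (hAm j).nullMeasurableSet) hdisj hFint
  have hterm : ∀ j, ∫ ω in countEvent ε s j, F ω ∂Pr =
      (convCdf ψ j s - convCdf ψ (j + 1) s) * plancherel ζ +
        (1 - 1 / (n : ℝ)) ^ j * (convCdf ψ j s - convCdf ψ (j + 1) s) *
          (∫ ω, (((Z 0 ω).entry ζ).card : ℝ) / n ∂Pr - plancherel ζ) := by
    intro j
    rw [setIntegral_congr_ae (g := fun ω => f (Z j ω)) (hAm j) (hFj j),
      ← integral_indicator (hAm j)]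
    let B : Set (ℕ → ℝ) := {e | ∑ i ∈ Finset.range j, e i ≤ s ∧
      s < ∑ i ∈ Finset.range (j + 1), e i}
    have hB : MeasurableSet B :=
      (measurableSet_le (f := fun e : ℕ → ℝ => ∑ i ∈ Finset.range j, e i) (by fun_prop)
        measurable_const).inter (measurableSet_lt
          (g := fun e : ℕ → ℝ => ∑ i ∈ Finset.range (j + 1), e i) measurable_const (by fun_prop))
    have hind : IndepFun (fun ω => f (Z j ω))
        (fun ω => B.indicator (fun _ => (1 : ℝ)) fun i => ε i ω) Pr :=
      h.indep_chain_pause.comp (φ := fun z : ℕ → MultiDiagram T n => f (z j))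
        (ψ := B.indicator fun _ => (1 : ℝ)) (hfm.comp (measurable_pi_apply j))
        (measurable_const.indicator hB)
    have hmε : Measurable fun ω => fun i => ε i ω :=
      measurable_pi_lambda _ h.measurable_pause
    have hprod : ∀ ω, (countEvent ε s j).indicator (fun ω => f (Z j ω)) ω =
        f (Z j ω) * B.indicator (fun _ => (1 : ℝ)) (fun i => ε i ω) := by
      intro ω
      by_cases hω : ω ∈ countEvent ε s j
      · have hω' : (fun i => ε i ω) ∈ B := hω
        rw [Set.indicator_of_mem hω, Set.indicator_of_mem hω', mul_one]
      · have hω' : (fun i => ε i ω) ∉ B := hω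
        rw [Set.indicator_of_notMem hω, Set.indicator_of_notMem hω', mul_zero]
    have hBint : ∫ ω, B.indicator (fun _ => (1 : ℝ)) (fun i => ε i ω) ∂Pr =
        Pr.real (countEvent ε s j) := by
      have : ∀ ω, B.indicator (fun _ => (1 : ℝ)) (fun i => ε i ω) =
          (countEvent ε s j).indicator (fun _ => (1 : ℝ)) ω := fun ω => rfl
      simp only [this]
      rw [integral_indicator (hAm j)]
      simp
    simp only [hprod]
    rw [hind.integral_fun_mul_eq_mul_integral
      (hfm.comp (h.measurable_chain j)).aestronglyMeasurable
      ((measurable_const.indicator hB).comp hmε).aestronglyMeasurable, hBint,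
      h.prob_countEvent hψ]
    have := h.integral_card hn ζ j
    simp only [f]
    rw [this]
    ring
  have hleft : ∫ ω in ⋃ j, countEvent ε s j, F ω ∂Pr = meanSize Pr Z ε ζ s := by
    rw [setIntegral_eq_integral_of_ae_compl_eq_zero]
    · rfl
    · filter_upwards [hU] with ω hω hω'
      exact absurd hω hω'
  rw [hleft] at hsum
  simp only [hterm] at hsum
  have hq : Summable fun j : ℕ =>
      (1 - 1 / (n : ℝ)) ^ j * (convCdf ψ j s - convCdf ψ (j + 1) s) := by
    simp only [mul_sub]
    exact (summable_pow_mul_convCdf hn s 0).sub (summable_pow_mul_convCdf hn s 1)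
  have h1 := (h.hasSum_prob_countEvent hψ hs).mul_right (plancherel ζ)
  have h2 := hq.hasSum.mul_right (∫ ω, (((Z 0 ω).entry ζ).card : ℝ) / n ∂Pr - plancherel ζ)
  rw [hsum.unique (h1.add h2), pauseCoeff_eq_tsum hψ, one_mul]

end Chain

theorem tendsto_floor_succ_div {x : ℝ} (hx : 0 ≤ x) :
    Tendsto (fun n : ℕ => ((⌊n * x⌋₊ + 1 : ℕ) : ℝ) / n) atTop (𝓝 x) := by
  have h1 : Tendsto (fun n : ℕ => (⌊(n : ℝ) * x⌋₊ : ℝ) / n) atTop (𝓝 x) := by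
    have := (tendsto_nat_floor_mul_div_atTop (R := ℝ) hx).comp tendsto_natCast_atTop_atTop
    refine this.congr fun n => ?_
    simp [mul_comm]
  have h2 := h1.add (tendsto_one_div_atTop_nhds_zero_nat (𝕜 := ℝ))
  rw [add_zero] at h2
  refine h2.congr fun n => ?_
  push_cast
  ring

/-! ### Pausing times with finite mean -/

section FiniteMean

variable {T : Type*} [Group T] [Finite T] {k : ℕ} {ψ : Measure ℝ}
  {Ω : Type*} [MeasurableSpace Ω] {Pr : Measure Ω}
  {Z : ℕ → Ω → MultiDiagram T k} {ε : ℕ → Ω → ℝ}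

theorem mean_pos [IsProbabilityMeasure ψ] (hψ : ψ (Set.Iic 0) = 0)
    (hint : Integrable (fun x : ℝ => x) ψ) : 0 < ∫ x, x ∂ψ := by
  have hpos : ∀ᵐ x ∂ψ, 0 < x := by
    rw [ae_iff]
    simpa [Set.Iic] using hψ
  rw [integral_pos_iff_support_of_nonneg_ae (hpos.mono fun x hx => hx.le) hint]
  have : (Function.support fun x : ℝ => x) =ᵐ[ψ] Set.univ := by
    filter_upwards [hpos] with x hx
    simp only [eq_iff_iff]
    change (x ≠ 0) ↔ True
    simp [hx.ne']
  rw [measure_congr this, measure_univ]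
  exact one_pos

/-- The strong law of large numbers for the renewal epochs. -/
theorem IsPausedChain.ae_tendsto_epoch (h : IsPausedChain ψ Pr Z ε)
    (hint : Integrable (fun x : ℝ => x) ψ) :
    ∀ᵐ ω ∂Pr, Tendsto (fun j : ℕ => epoch ε j ω / j) atTop (𝓝 (∫ x, x ∂ψ)) := by
  have hmean : ∫ x, x ∂ψ = ∫ ω, ε 0 ω ∂Pr := by
    rw [← h.law_pause 0]
    exact integral_map (h.measurable_pause 0).aemeasurable aestronglyMeasurable_id
  rw [hmean]
  refine strong_law_ae_real ε ?_ ?_ ?_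
  · rw [← h.law_pause 0] at hint
    exact hint.comp_measurable (h.measurable_pause 0)
  · intro i j hij
    exact h.iIndep_pause.indepFun hij
  · intro i
    exact ⟨(h.measurable_pause i).aemeasurable, (h.measurable_pause 0).aemeasurable,
      by rw [h.law_pause, h.law_pause]⟩

variable [IsProbabilityMeasure Pr]

theorem IsPausedChain.tendsto_convCdf_of_integrable (h : IsPausedChain ψ Pr Z ε)
    (hint : Integrable (fun x : ℝ => x) ψ) (hm : 0 < ∫ x, x ∂ψ) {t x : ℝ} (hx : 0 ≤ x)
    (hxt : x ≠ t / ∫ x, x ∂ψ) :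
    Tendsto (fun n : ℕ => convCdf ψ (⌊n * x⌋₊ + 1) (t * n)) atTop
      (𝓝 ((Set.Iio (t / ∫ x, x ∂ψ)).indicator 1 x)) := by
  set m := ∫ x, x ∂ψ
  have hJ := tendsto_floor_succ_div hx
  have hae : ∀ᵐ ω ∂Pr, Tendsto (fun n : ℕ => epoch ε (⌊n * x⌋₊ + 1) ω / n) atTop
      (𝓝 (m * x)) := by
    rcases hx.eq_or_lt with rfl | hx0
    · refine Eventually.of_forall fun ω => ?_
      simp only [mul_zero, Nat.floor_zero]
      exact tendsto_const_nhds.div_atTop tendsto_natCast_atTop_atTop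
    filter_upwards [h.ae_tendsto_epoch hint] with ω hω
    have hJinf : Tendsto (fun n : ℕ => ⌊n * x⌋₊ + 1) atTop atTop :=
      (tendsto_add_atTop_nat 1).comp
        (tendsto_nat_floor_atTop.comp (tendsto_natCast_atTop_atTop.atTop_mul_const hx0))
    refine ((hω.comp hJinf).mul hJ).congr fun n => ?_
    have : ((⌊n * x⌋₊ + 1 : ℕ) : ℝ) ≠ 0 := by positivity
    simp only [Function.comp_apply]
    field_simp
  have hind : Tendsto (fun n : ℕ => ∫ ω, {ω | epoch ε (⌊n * x⌋₊ + 1) ω ≤ t * n}.indicator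
      (fun _ => (1 : ℝ)) ω ∂Pr) atTop
      (𝓝 (∫ _, (Set.Iio (t / m)).indicator (1 : ℝ → ℝ) x ∂Pr)) := by
    refine tendsto_integral_of_dominated_convergence (fun _ => 1) (fun n => ?_)
      (integrable_const _) (fun n => Eventually.of_forall fun ω => ?_) ?_
    · exact (measurable_const.indicator
        (measurableSet_le (h.measurable_epoch _) measurable_const)).aestronglyMeasurable
    · refine (norm_indicator_le_norm_self _ _).trans ?_
      simp
    · filter_upwards [hae] with ω hω
      rcases lt_or_gt_of_ne hxt with hlt | hgt
      · rw [Set.indicator_of_mem (show x ∈ Set.Iio (t / m) from hlt)]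
        have hlt' : m * x < t := by rw [lt_div_iff₀ hm] at hlt; linarith
        refine tendsto_const_nhds.congr' ?_
        filter_upwards [hω.eventually_lt_const hlt', eventually_ge_atTop 1] with n hn hn1
        have hn0 : (0 : ℝ) < n := by exact_mod_cast hn1
        rw [Set.indicator_of_mem]
        · rfl
        · rw [div_lt_iff₀ hn0] at hn
          exact hn.le
      · rw [Set.indicator_of_notMem (show x ∉ Set.Iio (t / m) from not_lt.2 hgt.le)]
        have hlt' : t < m * x := by rw [div_lt_iff₀ hm] at hgt; linarith
        refine tendsto_const_nhds.congr' ?_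
        filter_upwards [hω.eventually_const_lt hlt', eventually_ge_atTop 1] with n hn hn1
        have hn0 : (0 : ℝ) < n := by exact_mod_cast hn1
        rw [Set.indicator_of_notMem]
        rw [lt_div_iff₀ hn0] at hn
        exact not_le.2 hn
  simp only [integral_const, probReal_univ, one_smul] at hind
  refine hind.congr fun n => ?_
  rw [h.convCdf_eq, integral_indicator (measurableSet_le (h.measurable_epoch _) measurable_const)]
  simp

theorem IsPausedChain.tendsto_pauseCoeff_of_integrable [IsProbabilityMeasure ψ]
    (h : IsPausedChain ψ Pr Z ε) (hψ : ψ (Set.Iic 0) = 0)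
    (hint : Integrable (fun x : ℝ => x) ψ) {t : ℝ} (ht : 0 ≤ t) :
    Tendsto (fun n : ℕ => pauseCoeff ψ 1 n (t * n)) atTop (𝓝 (finiteMeanCoeff ψ 1 t)) := by
  have hm := mean_pos hψ hint
  have hlim := tendsto_pauseCoeff (s := fun n : ℕ => t * n)
    (G := (Set.Iio (t / ∫ x, x ∂ψ)).indicator 1) hψ (fun n => by positivity) (by
      filter_upwards [ae_restrict_mem measurableSet_Ioi,
        ae_restrict_of_ae (Measure.ae_ne volume (t / ∫ x, x ∂ψ))] with x hx hne
      exact h.tendsto_convCdf_of_integrable hint hm (le_of_lt hx) hne)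
  convert hlim using 2
  set m := ∫ x, x ∂ψ with hmdef
  have htm : 0 ≤ t / m := by positivity
  have hf : ∀ x : ℝ, Real.exp (-x) * (Set.Iio (t / m)).indicator 1 x =
      (Set.Iio (t / m)).indicator (fun x => Real.exp (-x)) x := by
    intro x
    by_cases hx : x ∈ Set.Iio (t / m)
    · simp [Set.indicator_of_mem hx]
    · simp [Set.indicator_of_notMem hx]
  simp only [hf]
  rw [setIntegral_indicator measurableSet_Iio, Set.Ioi_inter_Iio, ← integral_Ioc_eq_integral_Ioo,
    ← intervalIntegral.integral_of_le htm, intervalIntegral.integral_comp_neg (f := Real.exp),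
    integral_exp, finiteMeanCoeff, ← hmdef]
  simp

end FiniteMean

/-! ### Stable pausing times: scaling -/

section Stable

variable {ψ : Measure ℝ} [IsProbabilityMeasure ψ] {α : ℝ}

theorem charFun_convPow (j : ℕ) (u : ℝ) : charFun (convPow ψ j) u = charFun ψ u ^ j := by
  induction j with
  | zero => simp [convPow, charFun_apply]
  | succ j ih => rw [convPow, charFun_conv, ih, pow_succ]

theorem convPow_eq_map (hα : 0 < α) (hS : IsOneSidedStable α ψ) {j : ℕ} (hj : j ≠ 0) :
    convPow ψ j = ψ.map fun x => (j : ℝ) ^ (1 / α) * x := by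
  have hj0 : (0 : ℝ) < j := by exact_mod_cast Nat.pos_of_ne_zero hj
  have hc : 0 < (j : ℝ) ^ (1 / α) := Real.rpow_pos_of_pos hj0 _
  have : IsProbabilityMeasure (ψ.map fun x => (j : ℝ) ^ (1 / α) * x) :=
    Measure.isProbabilityMeasure_map (by fun_prop)
  refine Measure.ext_of_charFun (funext fun u => ?_)
  rw [charFun_convPow, charFun_map_mul, hS u, hS, ← Complex.exp_nat_mul]
  have hsign : Real.sign ((j : ℝ) ^ (1 / α) * u) = Real.sign u := by
    rcases lt_trichotomy u 0 with hu | rfl | hu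
    · rw [Real.sign_of_neg hu, Real.sign_of_neg (mul_neg_of_pos_of_neg hc hu)]
    · simp
    · rw [Real.sign_of_pos hu, Real.sign_of_pos (mul_pos hc hu)]
  have habs : |(j : ℝ) ^ (1 / α) * u| ^ α = j * |u| ^ α := by
    rw [abs_mul, abs_of_pos hc, Real.mul_rpow hc.le (abs_nonneg u), ← Real.rpow_mul hj0.le,
      one_div, inv_mul_cancel₀ hα.ne', Real.rpow_one]
  rw [hsign, habs]
  congr 1
  push_cast
  ring

theorem convCdf_stable (hα : 0 < α) (hS : IsOneSidedStable α ψ) {j : ℕ} (hj : j ≠ 0) (s : ℝ) :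
    convCdf ψ j s = ψ.real (Set.Iic (s / (j : ℝ) ^ (1 / α))) := by
  have hj0 : (0 : ℝ) < j := by exact_mod_cast Nat.pos_of_ne_zero hj
  have hc : 0 < (j : ℝ) ^ (1 / α) := Real.rpow_pos_of_pos hj0 _
  rw [convCdf, convPow_eq_map hα hS hj, map_measureReal_apply (by fun_prop) measurableSet_Iic]
  congr 1
  ext x
  simp only [Set.mem_preimage, Set.mem_Iic]
  rw [le_div_iff₀ hc, mul_comm]

theorem tendsto_pauseCoeff_stable (hψ : ψ (Set.Iic 0) = 0) (hα : 0 < α)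
    (hS : IsOneSidedStable α ψ) {t : ℝ} (ht : 0 ≤ t) :
    Tendsto (fun n : ℕ => pauseCoeff ψ 1 n (t * (n : ℝ) ^ (1 / α))) atTop
      (𝓝 (1 - ∫ x in Set.Ioi (0 : ℝ),
        Real.exp (-x) * ψ.real (Set.Iic (t / x ^ (1 / α))))) := by
  refine tendsto_pauseCoeff hψ (fun n => by positivity) ?_
  have hmono : Monotone fun y => ψ.real (Set.Iic y) :=
    fun a b hab => measureReal_mono (Set.Iic_subset_Iic.2 hab)
  have hae : ∀ᵐ x : ℝ ∂(volume.restrict (Set.Ioi (0 : ℝ))),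
      t = 0 ∨ ContinuousAt (fun y => ψ.real (Set.Iic y)) (t / x ^ (1 / α)) := by
    rcases ht.eq_or_lt with rfl | ht0
    · exact Eventually.of_forall fun x => Or.inl rfl
    rw [ae_restrict_iff' measurableSet_Ioi]
    have hcount : {x : ℝ | 0 < x ∧
        ¬ ContinuousAt (fun y => ψ.real (Set.Iic y)) (t / x ^ (1 / α))}.Countable := by
      refine Set.MapsTo.countable_of_injOn (f := fun x : ℝ => t / x ^ (1 / α))
        (fun x hx => hx.2) ?_ hmono.countable_not_continuousAt
      intro x hx y hy hxy
      have hx0 : 0 < x := hx.1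
      have hy0 : 0 < y := hy.1
      have h1 : x ^ (1 / α) = y ^ (1 / α) := by
        have hx1 := (Real.rpow_pos_of_pos hx0 (1 / α)).ne'
        have hy1 := (Real.rpow_pos_of_pos hy0 (1 / α)).ne'
        simp only at hxy
        rw [div_eq_div_iff hx1 hy1] at hxy
        exact (mul_left_cancel₀ ht0.ne' hxy).symm
      exact (Real.rpow_left_inj hx0.le hy0.le (by positivity)).1 h1
    rw [ae_iff]
    refine measure_mono_null (fun x hx => ?_) (hcount.measure_zero volume)
    simp only [Set.mem_ofPred_eq, Classical.not_imp, not_or] at hx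
    exact ⟨hx.1, hx.2.2⟩
  filter_upwards [hae, ae_restrict_mem measurableSet_Ioi] with x hx hx0
  have hx0' : 0 < x := hx0
  simp only [convCdf_stable hα hS (Nat.succ_ne_zero _)]
  rcases hx with rfl | hx
  · simp
  · refine hx.tendsto.comp ?_
    have hJ := (tendsto_floor_succ_div hx0'.le).rpow_const (p := 1 / α) (Or.inl hx0'.ne')
    have hpow : x ^ (1 / α) ≠ 0 := (Real.rpow_pos_of_pos hx0' _).ne'
    refine ((tendsto_const_nhds (x := t)).div hJ hpow).congr' ?_
    filter_upwards [eventually_ge_atTop 1] with n hn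
    have hn0 : (0 : ℝ) < n := by exact_mod_cast hn
    have := (Real.rpow_pos_of_pos hn0 (1 / α)).ne'
    change t / (((⌊n * x⌋₊ + 1 : ℕ) : ℝ) / n) ^ (1 / α) =
      t * (n : ℝ) ^ (1 / α) / ((⌊n * x⌋₊ + 1 : ℕ) : ℝ) ^ (1 / α)
    rw [Real.div_rpow (Nat.cast_nonneg _) hn0.le, div_div_eq_mul_div]

end Stable

/-! ### A Cauchy integral formula on a strip -/

theorem exp_ne_exp_of_abs_im_sub_lt {w x : ℂ} (h : |w.im - x.im| < 2 * Real.pi) (hne : w ≠ x) :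
    Complex.exp w ≠ Complex.exp x := by
  intro he
  obtain ⟨n, hn⟩ := Complex.exp_eq_exp_iff_exists_int.1 he
  have him : w.im = x.im + n * (2 * Real.pi) := by
    have := congrArg Complex.im hn
    simpa using this
  have h1 : |(n : ℝ)| * (2 * Real.pi) < 1 * (2 * Real.pi) := by
    have hd : w.im - x.im = n * (2 * Real.pi) := by rw [him]; ring
    rwa [hd, abs_mul, abs_of_pos Real.two_pi_pos, ← one_mul (2 * Real.pi), ← mul_assoc,
      mul_one] at h
  have h2 : |(n : ℝ)| < 1 := lt_of_mul_lt_mul_right h1 Real.two_pi_pos.le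
  have h3 : n = 0 := by
    rw [← Int.abs_lt_one_iff]
    exact_mod_cast h2
  apply hne
  rw [hn, h3]
  simp

/-- The kernel of Cauchy's formula in the coordinate `w = log z`. -/
def expKernel (x w : ℂ) : ℂ := Complex.exp w / (Complex.exp w - Complex.exp x)

theorem expKernel_eq_left (x w : ℂ) :
    expKernel x w = Complex.exp (w - x) / (Complex.exp (w - x) - 1) := by
  have hx := Complex.exp_ne_zero x
  rw [expKernel, Complex.exp_sub, div_sub_one hx, div_div_div_cancel_right₀ hx]

theorem expKernel_eq_right (x w : ℂ) : expKernel x w = 1 / (1 - Complex.exp (x - w)) := by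
  have hw := Complex.exp_ne_zero w
  rw [expKernel, Complex.exp_sub, one_sub_div hw, one_div_div]

theorem tendsto_exp_sub_right (x : ℂ) (θ : ℝ) :
    Tendsto (fun R : ℝ => Complex.exp (x - (R + θ * Complex.I))) atTop (𝓝 0) := by
  rw [tendsto_zero_iff_norm_tendsto_zero]
  simp only [Complex.norm_exp]
  have : Tendsto (fun R : ℝ => x.re - R) atTop atBot :=
    tendsto_atBot_add_const_left _ _ tendsto_neg_atTop_atBot
  exact (Real.tendsto_exp_atBot.comp this).congr fun R => by simp

theorem tendsto_exp_sub_left (x : ℂ) (θ : ℝ) :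
    Tendsto (fun R : ℝ => Complex.exp (((-R : ℝ) + θ * Complex.I) - x)) atTop (𝓝 0) := by
  rw [tendsto_zero_iff_norm_tendsto_zero]
  simp only [Complex.norm_exp]
  have : Tendsto (fun R : ℝ => -R - x.re) atTop atBot :=
    tendsto_atBot_add_const_right _ _ tendsto_neg_atTop_atBot
  exact (Real.tendsto_exp_atBot.comp this).congr fun R => by simp

theorem tendsto_expKernel_right (x : ℂ) (θ : ℝ) :
    Tendsto (fun R : ℝ => expKernel x (R + θ * Complex.I)) atTop (𝓝 1) := by
  simp only [expKernel_eq_right]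
  have := (tendsto_const_nhds (x := (1 : ℂ))).div
    ((tendsto_exp_sub_right x θ).const_sub 1) (by simp)
  rw [sub_zero, div_one] at this
  exact this

theorem tendsto_expKernel_left (x : ℂ) (θ : ℝ) :
    Tendsto (fun R : ℝ => expKernel x ((-R : ℝ) + θ * Complex.I)) atTop (𝓝 0) := by
  simp only [expKernel_eq_left]
  have := (tendsto_exp_sub_left x θ).div ((tendsto_exp_sub_left x θ).sub_const 1) (by simp)
  rw [zero_div] at this
  exact this

theorem eventually_norm_expKernel_le (x : ℂ) : ∀ᶠ R : ℝ in atTop, ∀ θ : ℝ,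
    ‖expKernel x (R + θ * Complex.I)‖ ≤ 2 ∧
      ‖expKernel x ((-R : ℝ) + θ * Complex.I)‖ ≤ 2 := by
  have h1 : ∀ᶠ R : ℝ in atTop, ‖Complex.exp (x - (R + (0 : ℝ) * Complex.I))‖ < 1 / 2 :=
    (tendsto_zero_iff_norm_tendsto_zero.1 (tendsto_exp_sub_right x 0)).eventually_lt_const
      (by norm_num)
  have h2 : ∀ᶠ R : ℝ in atTop, ‖Complex.exp (((-R : ℝ) + (0 : ℝ) * Complex.I) - x)‖ < 1 / 2 :=
    (tendsto_zero_iff_norm_tendsto_zero.1 (tendsto_exp_sub_left x 0)).eventually_lt_const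
      (by norm_num)
  filter_upwards [h1, h2] with R h1 h2 θ
  constructor
  · have h3 : ‖Complex.exp (x - (R + θ * Complex.I))‖ < 1 / 2 := by
      simpa [Complex.norm_exp] using h1
    rw [expKernel_eq_right, norm_div, norm_one, div_le_iff₀]
    · have := norm_sub_norm_le (1 : ℂ) (Complex.exp (x - (R + θ * Complex.I)))
      rw [norm_one] at this
      linarith
    · have := norm_sub_norm_le (1 : ℂ) (Complex.exp (x - (R + θ * Complex.I)))
      rw [norm_one] at this
      linarith
  · have h3 : ‖Complex.exp (((-R : ℝ) + θ * Complex.I) - x)‖ < 1 / 2 := by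
      simpa [Complex.norm_exp] using h2
    have := norm_sub_norm_le (1 : ℂ) (Complex.exp (((-R : ℝ) + θ * Complex.I) - x))
    rw [norm_one, norm_sub_rev] at this
    rw [expKernel_eq_left, norm_div, div_le_iff₀ (by linarith)]
    linarith

/-- A function on the strip `|Im w| ≤ π` that decays at the right end is recovered from its jump
across the two boundary lines. In the coordinate `z = exp w` this is Cauchy's formula for a keyhole
contour around the negative half-line. -/
theorem tendsto_integral_jump_mul {Φ : ℂ → ℂ} {b M : ℝ} (hb : Real.pi < b)
    (hΦ : DifferentiableOn ℂ Φ {w | |w.im| < b}) {x : ℂ} (hx : |x.im| < Real.pi)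
    (hright : ∀ θ : ℝ, Tendsto (fun R : ℝ => Φ (R + θ * Complex.I)) atTop (𝓝 0))
    (hM : ∀ᶠ R : ℝ in atTop, ∀ θ : ℝ, |θ| ≤ Real.pi →
      ‖Φ (R + θ * Complex.I)‖ ≤ M ∧ ‖Φ ((-R : ℝ) + θ * Complex.I)‖ ≤ M)
    (hleft : ∀ θ : ℝ, ∃ l, Tendsto (fun R : ℝ => Φ ((-R : ℝ) + θ * Complex.I)) atTop (𝓝 l)) :
    Tendsto (fun R : ℝ => ∫ y in (-R)..R,
      (Φ (y - Real.pi * Complex.I) - Φ (y + Real.pi * Complex.I)) *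
        (Complex.exp y / (Complex.exp y + Complex.exp x))) atTop
      (𝓝 (2 * Real.pi * Complex.I * Φ x)) := by
  have hpi := Real.pi_pos
  -- on the strip of half-width `b'` the only zero of `exp w - exp x` is `x`
  set b' := min b (2 * Real.pi - |x.im|) with hb'
  have hb'π : Real.pi < b' := lt_min hb (by linarith)
  set U : Set ℂ := {w | |w.im| < b'} with hU
  have hUo : IsOpen U := isOpen_lt (by fun_prop) continuous_const
  have hxU : U ∈ 𝓝 x := hUo.mem_nhds (show |x.im| < b' by linarith)
  have hne : ∀ w ∈ U, w ≠ x → Complex.exp w ≠ Complex.exp x := by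
    intro w hw hwx
    refine exp_ne_exp_of_abs_im_sub_lt ?_ hwx
    have h1 : |w.im| < 2 * Real.pi - |x.im| := lt_of_lt_of_le hw (min_le_right _ _)
    have h2 := abs_sub w.im x.im
    linarith
  -- the quotient is regular at `x`, since both slopes extend holomorphically
  let G : ℂ → ℂ := fun w => dslope Φ x w * (Complex.exp w / dslope Complex.exp x w)
  have hGeq : ∀ w ∈ U, w ≠ x → G w = (Φ w - Φ x) * expKernel x w := by
    intro w hw hwx
    have h1 := sub_ne_zero.2 (hne w hw hwx)
    have h2 := sub_ne_zero.2 hwx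
    simp only [G, expKernel, dslope_of_ne _ hwx, slope_def_field]
    field_simp
  have hGd : DifferentiableOn ℂ G U := by
    refine DifferentiableOn.mul ?_ (DifferentiableOn.div Complex.differentiable_exp.differentiableOn
      ?_ ?_)
    · exact (Complex.differentiableOn_dslope hxU).2
        (hΦ.mono fun w (hw : |w.im| < b') => show |w.im| < b from hw.trans_le (min_le_left _ _))
    · exact (Complex.differentiableOn_dslope hxU).2 Complex.differentiable_exp.differentiableOn
    · intro w hw
      by_cases hwx : w = x
      · rw [hwx, dslope_same, Complex.deriv_exp]
        exact Complex.exp_ne_zero x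
      · rw [dslope_of_ne _ hwx, slope_def_field]
        exact div_ne_zero (sub_ne_zero.2 (hne w hw hwx)) (sub_ne_zero.2 hwx)
  have hGc : ContinuousOn G U := hGd.continuousOn
  have hlineU : ∀ (y θ : ℝ), |θ| ≤ Real.pi → (y + θ * Complex.I : ℂ) ∈ U := by
    intro y θ hθ
    change |(y + θ * Complex.I : ℂ).im| < b'
    simp only [Complex.add_im, Complex.ofReal_im, Complex.mul_im, Complex.ofReal_re,
      Complex.I_im, mul_one, Complex.I_re, mul_zero, zero_add, add_zero]
    linarith
  have hIcc : ∀ θ ∈ Set.uIcc (-Real.pi) Real.pi, |θ| ≤ Real.pi := by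
    intro θ hθ
    rw [Set.uIcc_of_le (by linarith)] at hθ
    exact abs_le.2 hθ
  have hvert : ∀ R : ℝ, ContinuousOn (fun θ : ℝ => G (R + θ * Complex.I))
      (Set.uIcc (-Real.pi) Real.pi) := fun R =>
    hGc.comp (by fun_prop) fun θ hθ => hlineU R θ (hIcc θ hθ)
  have hIoc : ∀ θ ∈ Set.uIoc (-Real.pi) Real.pi, |θ| ≤ Real.pi := fun θ hθ =>
    hIcc θ (Set.uIoc_subset_uIcc hθ)
  have hmeas : ∀ R : ℝ, AEStronglyMeasurable (fun θ : ℝ => G (R + θ * Complex.I))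
      (volume.restrict (Set.uIoc (-Real.pi) Real.pi)) := fun R =>
    ((hvert R).mono Set.uIoc_subset_uIcc).aestronglyMeasurable measurableSet_uIoc
  have hne_right : ∀ R : ℝ, x.re < R → ∀ θ : ℝ, (R + θ * Complex.I : ℂ) ≠ x := by
    intro R hR θ he
    have := congrArg Complex.re he
    simp at this
    linarith
  have hne_left : ∀ R : ℝ, -x.re < R → ∀ θ : ℝ, ((-R : ℝ) + θ * Complex.I : ℂ) ≠ x := by
    intro R hR θ he
    have := congrArg Complex.re he
    simp at this
    linarith
  have hbound : ∀ᶠ R : ℝ in atTop, ∀ θ : ℝ, |θ| ≤ Real.pi →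
      ‖G (R + θ * Complex.I)‖ ≤ (M + ‖Φ x‖) * 2 ∧
        ‖G ((-R : ℝ) + θ * Complex.I)‖ ≤ (M + ‖Φ x‖) * 2 := by
    filter_upwards [hM, eventually_norm_expKernel_le x, eventually_gt_atTop x.re,
      eventually_gt_atTop (-x.re)] with R h1 h2 h3 h4 θ hθ
    obtain ⟨h5, h6⟩ := h1 θ hθ
    have hM0 : 0 ≤ M := (norm_nonneg _).trans h5
    constructor
    · rw [hGeq _ (hlineU R θ hθ) (hne_right R h3 θ), norm_mul]
      gcongr
      · exact (norm_sub_le _ _).trans (by linarith)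
      · exact (h2 θ).1
    · rw [hGeq _ (hlineU (-R) θ hθ) (hne_left R h4 θ), norm_mul]
      gcongr
      · exact (norm_sub_le _ _).trans (by linarith)
      · exact (h2 θ).2
  have hR : Tendsto (fun R : ℝ => ∫ θ in (-Real.pi)..Real.pi, G (R + θ * Complex.I)) atTop
      (𝓝 (∫ _ in (-Real.pi)..Real.pi, -Φ x)) := by
    refine intervalIntegral.tendsto_integral_filter_of_dominated_convergence
      (fun _ => (M + ‖Φ x‖) * 2) (Eventually.of_forall hmeas) ?_ (by simp) ?_
    · filter_upwards [hbound] with R hR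
      exact Eventually.of_forall fun θ hθ => (hR θ (hIoc θ hθ)).1
    · refine Eventually.of_forall fun θ hθ => ?_
      have := ((hright θ).sub_const (Φ x)).mul (tendsto_expKernel_right x θ)
      rw [zero_sub, mul_one] at this
      refine this.congr' ?_
      filter_upwards [eventually_gt_atTop x.re] with R h3
      exact (hGeq _ (hlineU R θ (hIoc θ hθ)) (hne_right R h3 θ)).symm
  have hL : Tendsto (fun R : ℝ => ∫ θ in (-Real.pi)..Real.pi, G ((-R : ℝ) + θ * Complex.I)) atTop
      (𝓝 (∫ _ in (-Real.pi)..Real.pi, (0 : ℂ))) := by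
    refine intervalIntegral.tendsto_integral_filter_of_dominated_convergence
      (fun _ => (M + ‖Φ x‖) * 2) (Eventually.of_forall fun R => hmeas (-R)) ?_ (by simp) ?_
    · filter_upwards [hbound] with R hR
      exact Eventually.of_forall fun θ hθ => (hR θ (hIoc θ hθ)).2
    · refine Eventually.of_forall fun θ hθ => ?_
      obtain ⟨l, hl⟩ := hleft θ
      have := (hl.sub_const (Φ x)).mul (tendsto_expKernel_left x θ)
      rw [mul_zero] at this
      refine this.congr' ?_
      filter_upwards [eventually_gt_atTop (-x.re)] with R h3
      exact (hGeq _ (hlineU (-R) θ (hIoc θ hθ)) (hne_left R h3 θ)).symm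
  have hlim := (hL.sub hR).const_mul Complex.I
  have hval : Complex.I * ((∫ _ in (-Real.pi)..Real.pi, (0 : ℂ)) -
      ∫ _ in (-Real.pi)..Real.pi, -Φ x) = 2 * Real.pi * Complex.I * Φ x := by
    simp
    ring
  rw [hval] at hlim
  refine hlim.congr fun R => ?_
  have hrect := Complex.integral_boundary_rect_eq_zero_of_differentiableOn G
    ((-R : ℝ) + (-Real.pi : ℝ) * Complex.I) (R + Real.pi * Complex.I) (hGd.mono (by
      intro w hw
      have h1 : w.im ∈ Set.uIcc (-Real.pi) Real.pi := by simpa using hw.2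
      exact lt_of_le_of_lt (hIcc _ h1) hb'π))
  have hre1 : ((-R : ℝ) + (-Real.pi : ℝ) * Complex.I : ℂ).re = -R := by simp
  have hre2 : (R + Real.pi * Complex.I : ℂ).re = R := by simp
  have him1 : ((-R : ℝ) + (-Real.pi : ℝ) * Complex.I : ℂ).im = -Real.pi := by simp
  have him2 : (R + Real.pi * Complex.I : ℂ).im = Real.pi := by simp
  rw [hre1, hre2, him1, him2] at hrect
  have hpi_abs : |Real.pi| ≤ Real.pi := (abs_of_pos hpi).le
  have hpi_abs' : |-Real.pi| ≤ Real.pi := by rw [abs_neg]; exact hpi_abs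
  have hcb : Continuous fun y : ℝ => G (y + (-Real.pi : ℝ) * Complex.I) :=
    hGc.comp_continuous (by fun_prop) fun y => hlineU y _ hpi_abs'
  have hct : Continuous fun y : ℝ => G (y + Real.pi * Complex.I) :=
    hGc.comp_continuous (by fun_prop) fun y => hlineU y _ hpi_abs
  rw [← intervalIntegral.integral_sub (hcb.intervalIntegrable _ _)
    (hct.intervalIntegrable _ _)] at hrect
  have hjump : ∀ y : ℝ, G (y + (-Real.pi : ℝ) * Complex.I) - G (y + Real.pi * Complex.I) =
      (Φ (y - Real.pi * Complex.I) - Φ (y + Real.pi * Complex.I)) *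
        (Complex.exp y / (Complex.exp y + Complex.exp x)) := by
    intro y
    have hker : ∀ θ : ℝ, Complex.exp (θ * Complex.I) = -1 →
        expKernel x (y + θ * Complex.I) = Complex.exp y / (Complex.exp y + Complex.exp x) := by
      intro θ hθ
      rw [expKernel, Complex.exp_add, hθ, mul_neg_one, ← neg_add', neg_div_neg_eq]
    have hnx : ∀ θ : ℝ, |θ| = Real.pi → (y + θ * Complex.I : ℂ) ≠ x := by
      intro θ hθ he
      have := congrArg Complex.im he
      simp at this
      rw [← this, hθ] at hx
      exact lt_irrefl _ hx
    rw [hGeq _ (hlineU y _ hpi_abs') (hnx _ (by rw [abs_neg, abs_of_pos hpi])),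
      hGeq _ (hlineU y _ hpi_abs) (hnx _ (abs_of_pos hpi)), hker Real.pi Complex.exp_pi_mul_I,
      hker (-Real.pi) (by
        rw [Complex.ofReal_neg, neg_mul, Complex.exp_neg, Complex.exp_pi_mul_I]; norm_num)]
    rw [Complex.ofReal_neg, neg_mul, ← sub_eq_add_neg]
    ring
  simp only [hjump, smul_eq_mul] at hrect
  linear_combination -hrect

/-! ### The density of the ratio of two stable variables -/

/-- The function `sin πα / (πα (u² + 2 u cos πα + 1))`, which is the density on `(0, ∞)` of
`(S / S')^α` for independent one-sided stable variables `S`, `S'` of exponent `α`. -/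
def stableWeight (α u : ℝ) : ℝ :=
  Real.sin (Real.pi * α) / (Real.pi * α) / (u ^ 2 + 2 * u * Real.cos (Real.pi * α) + 1)

section Weight

variable {α : ℝ}

theorem sin_pi_mul_pos (h0 : 0 < α) (h1 : α < 1) : 0 < Real.sin (Real.pi * α) := by
  have := Real.pi_pos
  exact Real.sin_pos_of_pos_of_lt_pi (by positivity) (by nlinarith)

theorem stable_denom_pos (h0 : 0 < α) (h1 : α < 1) (u : ℝ) :
    0 < u ^ 2 + 2 * u * Real.cos (Real.pi * α) + 1 := by
  have hs := sin_pi_mul_pos h0 h1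
  have := Real.sin_sq_add_cos_sq (Real.pi * α)
  nlinarith [sq_nonneg (u + Real.cos (Real.pi * α)), sq_pos_of_pos hs]

theorem stableWeight_nonneg (h0 : 0 < α) (h1 : α < 1) (u : ℝ) : 0 ≤ stableWeight α u := by
  have := sin_pi_mul_pos h0 h1
  have := stable_denom_pos h0 h1 u
  have := Real.pi_pos
  unfold stableWeight
  positivity

theorem continuous_stableWeight (h0 : 0 < α) (h1 : α < 1) : Continuous (stableWeight α) := by
  unfold stableWeight
  exact continuous_const.div (by fun_prop) fun u => (stable_denom_pos h0 h1 u).ne'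

theorem integrable_stableWeight (h0 : 0 < α) (h1 : α < 1) : Integrable (stableWeight α) := by
  have hs := sin_pi_mul_pos h0 h1
  set c := |Real.cos (Real.pi * α)| with hc
  have hc1 : c < 1 := by
    rw [hc, ← sq_lt_one_iff_abs_lt_one]
    nlinarith [Real.sin_sq_add_cos_sq (Real.pi * α), sq_pos_of_pos hs]
  have hK : 0 ≤ Real.sin (Real.pi * α) / (Real.pi * α) := by
    have := Real.pi_pos
    positivity
  refine ((integrable_inv_one_add_sq).const_mul
    (Real.sin (Real.pi * α) / (Real.pi * α) / (1 - c))).mono'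
    (continuous_stableWeight h0 h1).aestronglyMeasurable (Eventually.of_forall fun u => ?_)
  rw [Real.norm_of_nonneg (stableWeight_nonneg h0 h1 u), stableWeight, ← div_eq_mul_inv,
    div_div _ (1 - c)]
  have h2 : 0 < (1 - c) * (1 + u ^ 2) := mul_pos (by linarith) (by positivity)
  refine div_le_div_of_nonneg_left hK h2 ?_
  have h3 : -(c * |u|) ≤ u * Real.cos (Real.pi * α) := by
    rw [hc, mul_comm, ← abs_mul]
    exact neg_abs_le _
  have h4 : 2 * |u| ≤ 1 + u ^ 2 := by nlinarith [sq_nonneg (|u| - 1), sq_abs u]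
  nlinarith [abs_nonneg (Real.cos (Real.pi * α))]

/-- The Stieltjes-type integral of the density, by Cauchy's formula for `1 / (1 + z^α)` on the plane
cut along the negative half-line. -/
theorem integral_stableWeight_mul (h0 : 0 < α) (h1 : α < 1) {x : ℂ} (hx : |x.im| ≤ Real.pi / 2) :
    ∫ u in Set.Ioi (0 : ℝ), (stableWeight α u : ℂ) *
      (((u ^ (1 / α) : ℝ) : ℂ) / (((u ^ (1 / α) : ℝ) : ℂ) + Complex.exp x)) =
    1 / (1 + Complex.exp (α * x)) := by
  have hpi := Real.pi_pos
  let Φ : ℂ → ℂ := fun w => 1 / (1 + Complex.exp (α * w))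
  have hΦk : ∀ w, Φ w = expKernel (Real.pi * Complex.I) (-(α * w)) := by
    intro w
    rw [expKernel_eq_right, sub_neg_eq_add, Complex.exp_add, Complex.exp_pi_mul_I]
    simp only [Φ]
    ring_nf
  have hnz : ∀ w : ℂ, |w.im| < Real.pi / α → 1 + Complex.exp (α * w) ≠ 0 := by
    intro w hw h
    have h2 : |α * w.im| < Real.pi := by
      rw [abs_mul, abs_of_pos h0]
      rwa [lt_div_iff₀ h0, mul_comm] at hw
    obtain ⟨h3, h4⟩ := abs_lt.1 h2
    have him : (α * w : ℂ).im = α * w.im := by simp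
    have hE : Complex.exp (α * w) = -1 := by linear_combination h
    have hlog : (α * w : ℂ) = Complex.log (-1) := by
      rw [← hE, Complex.log_exp (by rw [him]; exact h3) (by rw [him]; exact h4.le)]
    have := congrArg Complex.im hlog
    rw [him, Complex.log_neg_one] at this
    simp at this
    linarith
  have hscale : Tendsto (fun R : ℝ => α * R) atTop atTop := tendsto_id.const_mul_atTop h0
  have hR1 : ∀ R θ : ℝ, -(α * (R + θ * Complex.I)) =
      (-(α * R) : ℝ) + (-(α * θ) : ℝ) * Complex.I := by
    intro R θ; push_cast; ring
  have hR2 : ∀ R θ : ℝ, -(α * ((-R : ℝ) + θ * Complex.I)) =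
      (α * R : ℝ) + (-(α * θ) : ℝ) * Complex.I := by
    intro R θ; push_cast; ring
  have hlim := tendsto_integral_jump_mul (Φ := Φ) (b := Real.pi / α) (M := 2) (x := x)
    (by rw [lt_div_iff₀ h0]; nlinarith) (by
      refine DifferentiableOn.div (differentiableOn_const _) (by fun_prop) fun w hw => hnz w hw)
    (by linarith) (by
      intro θ
      simp only [hΦk, hR1]
      exact (tendsto_expKernel_left (Real.pi * Complex.I) (-(α * θ))).comp hscale) (by
      filter_upwards [hscale.eventually (eventually_norm_expKernel_le (Real.pi * Complex.I))]
        with R hR θ _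
      refine ⟨?_, ?_⟩
      · rw [hΦk, hR1]
        exact (hR _).2
      · rw [hΦk, hR2]
        exact (hR _).1) (by
      intro θ
      refine ⟨1, ?_⟩
      simp only [hΦk, hR2]
      exact (tendsto_expKernel_right (Real.pi * Complex.I) (-(α * θ))).comp hscale)
  let H : ℝ → ℂ := fun u => (stableWeight α u : ℂ) *
      (((u ^ (1 / α) : ℝ) : ℂ) / (((u ^ (1 / α) : ℝ) : ℂ) + Complex.exp x))
  have hrex : 0 ≤ (Complex.exp x).re := by
    rw [Complex.exp_re]
    have := Real.cos_nonneg_of_neg_pi_div_two_le_of_le (abs_le.1 hx).1 (abs_le.1 hx).2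
    have := Real.exp_pos x.re
    positivity
  have hHint : IntegrableOn H (Set.Ioi 0) := by
    refine (integrable_stableWeight h0 h1).integrableOn.mono' ?_ ?_
    · refine Measurable.aestronglyMeasurable ?_
      have := (continuous_stableWeight h0 h1).measurable
      fun_prop
    · filter_upwards [ae_restrict_mem measurableSet_Ioi] with u hu
      have hr : 0 < u ^ (1 / α) := Real.rpow_pos_of_pos hu _
      rw [norm_mul, Complex.norm_real, Real.norm_of_nonneg (stableWeight_nonneg h0 h1 u), norm_div]
      refine mul_le_of_le_one_right (stableWeight_nonneg h0 h1 u) (div_le_one_of_le₀ ?_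
        (norm_nonneg _))
      rw [Complex.norm_real, Real.norm_of_nonneg hr.le]
      refine le_trans ?_ (Complex.re_le_norm _)
      simp only [Complex.add_re, Complex.ofReal_re]
      linarith
  -- the substitution `u = exp (α y)`, under which `u ^ (1 / α) = exp y`
  have himage : (fun y : ℝ => Real.exp (α * y)) '' Set.univ = Set.Ioi 0 := by
    ext u
    simp only [Set.image_univ, Set.mem_range, Set.mem_Ioi]
    constructor
    · rintro ⟨y, rfl⟩
      exact Real.exp_pos _
    · intro hu
      exact ⟨Real.log u / α, by rw [mul_div_cancel₀ _ h0.ne', Real.exp_log hu]⟩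
  have hderiv : ∀ y ∈ (Set.univ : Set ℝ), HasDerivWithinAt (fun y : ℝ => Real.exp (α * y))
      (α * Real.exp (α * y)) Set.univ y := by
    intro y _
    have := ((hasDerivAt_id y).const_mul α).exp
    simp only [id, mul_one] at this
    rw [mul_comm]
    exact this.hasDerivWithinAt
  have hinj : Set.InjOn (fun y : ℝ => Real.exp (α * y)) Set.univ := by
    intro y _ z _ h
    exact mul_left_cancel₀ h0.ne' (Real.exp_injective h)
  have hgint := (integrableOn_image_iff_integrableOn_abs_deriv_smul MeasurableSet.univ hderiv hinj
    H).1 (by rwa [himage])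
  have hgeq := integral_image_eq_integral_abs_deriv_smul MeasurableSet.univ hderiv hinj H
  rw [himage, setIntegral_univ] at hgeq
  rw [integrableOn_univ] at hgint
  have hcs :
      ((Real.cos (Real.pi * α) : ℝ) : ℂ) ^ 2 + ((Real.sin (Real.pi * α) : ℝ) : ℂ) ^ 2 = 1 := by
    exact_mod_cast Real.cos_sq_add_sin_sq (Real.pi * α)
  have hjump : ∀ y : ℝ, (Φ (y - Real.pi * Complex.I) - Φ (y + Real.pi * Complex.I)) *
        (Complex.exp y / (Complex.exp y + Complex.exp x)) =
      2 * Real.pi * Complex.I * (|α * Real.exp (α * y)| • H (Real.exp (α * y))) := by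
    intro y
    have hE := Real.exp_pos (α * y)
    have hpow : Real.exp (α * y) ^ (1 / α) = Real.exp y := by
      rw [← Real.exp_mul]; congr 1; field_simp
    have hstrip : ∀ θ : ℝ, |θ| = Real.pi → |(y + θ * Complex.I : ℂ).im| < Real.pi / α := by
      intro θ hθ
      have : (y + θ * Complex.I : ℂ).im = θ := by simp
      rw [this, hθ, lt_div_iff₀ h0]
      nlinarith
    have hn1 := hnz _ (hstrip (-Real.pi) (by rw [abs_neg, abs_of_pos hpi]))
    have hn2 := hnz _ (hstrip Real.pi (abs_of_pos hpi))
    have he1 : Complex.exp (α * (y + (-Real.pi : ℝ) * Complex.I)) = (Real.exp (α * y) : ℝ) *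
        ((Real.cos (Real.pi * α) : ℝ) - (Real.sin (Real.pi * α) : ℝ) * Complex.I) := by
      have : (α * (y + (-Real.pi : ℝ) * Complex.I) : ℂ) =
          ((α * y : ℝ) : ℂ) + (-(Real.pi * α : ℝ) : ℂ) * Complex.I := by push_cast; ring
      rw [this, Complex.exp_add, Complex.exp_mul_I, Complex.cos_neg, Complex.sin_neg]
      push_cast
      ring
    have he2 : Complex.exp (α * (y + Real.pi * Complex.I)) = (Real.exp (α * y) : ℝ) *
        ((Real.cos (Real.pi * α) : ℝ) + (Real.sin (Real.pi * α) : ℝ) * Complex.I) := by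
      have : (α * (y + Real.pi * Complex.I) : ℂ) =
          ((α * y : ℝ) : ℂ) + ((Real.pi * α : ℝ) : ℂ) * Complex.I := by push_cast; ring
      rw [this, Complex.exp_add, Complex.exp_mul_I]
      push_cast
      ring
    rw [he1] at hn1
    rw [he2] at hn2
    have hminus : (y - Real.pi * Complex.I : ℂ) = y + (-Real.pi : ℝ) * Complex.I := by
      push_cast; ring
    have hD : ((Real.exp (α * y) ^ 2 + 2 * Real.exp (α * y) * Real.cos (Real.pi * α) + 1 : ℝ) : ℂ)
        ≠ 0 := by
      exact_mod_cast (stable_denom_pos h0 h1 _).ne'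
    rw [abs_of_pos (by positivity), hminus]
    simp only [Φ, he1, he2, H, hpow, Complex.real_smul, stableWeight]
    rw [div_sub_div _ _ hn1 hn2]
    rw [Complex.ofReal_exp y]
    set K := Complex.exp (y : ℂ) / (Complex.exp y + Complex.exp x)
    rw [← mul_assoc, ← mul_assoc]
    congr 1
    set E := Real.exp (α * y)
    set c := Real.cos (Real.pi * α)
    set s := Real.sin (Real.pi * α)
    have hprod : (1 + (E : ℂ) * (c - s * Complex.I)) * (1 + (E : ℂ) * (c + s * Complex.I)) =
        ((E ^ 2 + 2 * E * c + 1 : ℝ) : ℂ) := by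
      push_cast
      linear_combination (E : ℂ) ^ 2 * hcs - (E : ℂ) ^ 2 * s ^ 2 * Complex.I_sq
    rw [hprod, div_eq_iff hD]
    have hα : (α : ℂ) ≠ 0 := by exact_mod_cast h0.ne'
    have hπ : (Real.pi : ℂ) ≠ 0 := by exact_mod_cast hpi.ne'
    have hw : ((s / (Real.pi * α) / (E ^ 2 + 2 * E * c + 1) : ℝ) : ℂ) =
        s / (Real.pi * α) / ((E ^ 2 + 2 * E * c + 1 : ℝ) : ℂ) := by push_cast; ring
    rw [hw, Complex.ofReal_mul]
    generalize ((E ^ 2 + 2 * E * c + 1 : ℝ) : ℂ) = D at hD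
    field_simp
    ring
  have hlim2 := intervalIntegral_tendsto_integral hgint tendsto_neg_atTop_atBot tendsto_id
  have hlim3 := hlim2.const_mul (2 * Real.pi * Complex.I)
  simp only [hjump, intervalIntegral.integral_const_mul] at hlim
  have huniq := tendsto_nhds_unique hlim hlim3
  have h2pi : (2 * Real.pi * Complex.I : ℂ) ≠ 0 := Complex.two_pi_I_ne_zero
  rw [← hgeq] at huniq
  exact (mul_left_cancel₀ h2pi huniq).symm

end Weight

/-! ### Two representations of the limit law of the stable regime -/

/-- The measure on `(0, ∞)` with density `ρ`. -/
def halfLineMeasure (ρ : ℝ → ℝ) : Measure ℝ :=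
  (volume.restrict (Set.Ioi 0)).withDensity fun x => ENNReal.ofReal (ρ x)

theorem isFiniteMeasure_halfLineMeasure {ρ : ℝ → ℝ} (hρ : IntegrableOn ρ (Set.Ioi 0)) :
    IsFiniteMeasure (halfLineMeasure ρ) :=
  isFiniteMeasure_withDensity_ofReal hρ.2

theorem integral_halfLineMeasure {E : Type*} [NormedAddCommGroup E] [NormedSpace ℝ E] {ρ : ℝ → ℝ}
    (hm : Measurable ρ) (h0 : ∀ x, 0 ≤ ρ x) (f : ℝ → E) :
    ∫ x, f x ∂(halfLineMeasure ρ) = ∫ x in Set.Ioi (0 : ℝ), ρ x • f x := by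
  rw [halfLineMeasure, integral_withDensity_eq_integral_toReal_smul (by fun_prop)
    (Eventually.of_forall fun x => ENNReal.ofReal_lt_top)]
  simp only [ENNReal.toReal_ofReal (h0 _)]

theorem real_map_prod {μ ν : Measure ℝ} [IsFiniteMeasure μ] [IsFiniteMeasure ν] {g : ℝ × ℝ → ℝ}
    (hg : Measurable g) {A : Set ℝ} (hA : MeasurableSet A) :
    ((μ.prod ν).map g).real A = ∫ x, ν.real {y | g (x, y) ∈ A} ∂μ := by
  rw [Measure.real, Measure.map_apply hg hA, Measure.prod_apply (hg hA)]
  exact (integral_toReal (measurable_measure_prodMk_left (hg hA)).aemeasurable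
    (Eventually.of_forall fun x => measure_lt_top _ _)).symm

theorem charFun_map_prod {μ ν : Measure ℝ} [IsFiniteMeasure μ] [IsFiniteMeasure ν] {g : ℝ × ℝ → ℝ}
    (hg : Measurable g) (ξ : ℝ) :
    charFun ((μ.prod ν).map g) ξ = ∫ x, ∫ y, Complex.exp (ξ * g (x, y) * Complex.I) ∂ν ∂μ := by
  rw [charFun_apply_real, integral_map hg.aemeasurable (by fun_prop), integral_prod]
  refine Integrable.of_bound (by fun_prop) 1 (Eventually.of_forall fun p => ?_)
  rw [← Complex.ofReal_mul, Complex.norm_exp_ofReal_mul_I]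

/-- The exponential law of parameter `1`. -/
def expLaw : Measure ℝ := halfLineMeasure fun x => Real.exp (-x)

instance isFiniteMeasure_expLaw : IsFiniteMeasure expLaw :=
  isFiniteMeasure_halfLineMeasure (integrableOn_exp_neg_Ioi 0)

theorem integral_expLaw {E : Type*} [NormedAddCommGroup E] [NormedSpace ℝ E] (f : ℝ → E) :
    ∫ x, f x ∂expLaw = ∫ x in Set.Ioi (0 : ℝ), Real.exp (-x) • f x :=
  integral_halfLineMeasure (by fun_prop) (fun x => (Real.exp_pos _).le) f

theorem expLaw_real_Ioi {a : ℝ} (ha : 0 ≤ a) : expLaw.real (Set.Ioi a) = Real.exp (-a) := by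
  have h1 : expLaw.real (Set.Ioi a) = ∫ x, (Set.Ioi a).indicator (fun _ => (1 : ℝ)) x ∂expLaw := by
    rw [integral_indicator measurableSet_Ioi]
    simp
  have h2 : ∀ x : ℝ, Real.exp (-x) • (Set.Ioi a).indicator (fun _ => (1 : ℝ)) x =
      (Set.Ioi a).indicator (fun x => Real.exp (-x)) x := by
    intro x
    by_cases hx : x ∈ Set.Ioi a
    · simp [Set.indicator_of_mem hx]
    · simp [Set.indicator_of_notMem hx]
  rw [h1, integral_expLaw]
  simp only [h2]
  rw [setIntegral_indicator measurableSet_Ioi, Set.Ioi_inter_Ioi, sup_eq_right.2 ha,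
    integral_exp_neg_Ioi]

theorem integral_expLaw_exp {θ : ℂ} (hθ : 0 ≤ θ.re) :
    ∫ x, Complex.exp (-(x * θ)) ∂expLaw = 1 / (1 + θ) := by
  have h : ∀ x : ℝ, Real.exp (-x) • Complex.exp (-(x * θ)) = Complex.exp (-(1 + θ) * x) := by
    intro x
    rw [Complex.real_smul, Complex.ofReal_exp, ← Complex.exp_add]
    congr 1
    push_cast
    ring
  rw [integral_expLaw]
  simp only [h]
  rw [integral_exp_mul_complex_Ioi (by simp; linarith)]
  rw [Complex.ofReal_zero, mul_zero, Complex.exp_zero, neg_div_neg_eq]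

/-- The exponent of the one-sided stable law. -/
def stableExponent (α ξ : ℝ) : ℂ :=
  ((|ξ| ^ α : ℝ) : ℂ) * (1 - Complex.I * ((Real.tan (Real.pi * α / 2) * Real.sign ξ : ℝ) : ℂ))

theorem stableExponent_re_nonneg (α ξ : ℝ) : 0 ≤ (stableExponent α ξ).re := by
  have : (stableExponent α ξ).re = |ξ| ^ α := by
    rw [stableExponent, Complex.re_ofReal_mul]
    generalize Real.tan (Real.pi * α / 2) * Real.sign ξ = r
    simp
  rw [this]
  positivity

/-- The law of `e^{1/α} S` for independent `e` exponential and `S` of law `ψ`. -/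
def mixedStableLaw (α : ℝ) (ψ : Measure ℝ) : Measure ℝ :=
  (expLaw.prod ψ).map fun p => p.1 ^ (1 / α) * p.2

/-- The mixture of the exponential laws of parameters `(u cos (πα/2))^{1/α}`, the mixing density
being `stableWeight α`. -/
def mixedExpLaw (α : ℝ) : Measure ℝ :=
  ((halfLineMeasure (stableWeight α)).prod expLaw).map fun p =>
    p.2 / (p.1 * Real.cos (Real.pi * α / 2)) ^ (1 / α)

section

variable {ψ : Measure ℝ} [IsProbabilityMeasure ψ] {α : ℝ}

theorem charFun_mixedStableLaw (hα : 0 < α) (hS : IsOneSidedStable α ψ) (ξ : ℝ) :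
    charFun (mixedStableLaw α ψ) ξ = 1 / (1 + stableExponent α ξ) := by
  rw [mixedStableLaw, charFun_map_prod (by fun_prop), integral_expLaw,
    ← integral_expLaw_exp (stableExponent_re_nonneg α ξ), integral_expLaw]
  refine setIntegral_congr_fun measurableSet_Ioi fun x hx => ?_
  have hx0 : 0 < x := hx
  have hc : 0 < x ^ (1 / α) := Real.rpow_pos_of_pos hx0 _
  have h1 : ∫ y, Complex.exp (ξ * ((x ^ (1 / α) * y : ℝ) : ℂ) * Complex.I) ∂ψ =
      charFun ψ (ξ * x ^ (1 / α)) := by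
    rw [charFun_apply_real]
    refine integral_congr_ae (Eventually.of_forall fun y => ?_)
    simp only
    push_cast
    ring_nf
  have hsign : Real.sign (ξ * x ^ (1 / α)) = Real.sign ξ := by
    rcases lt_trichotomy ξ 0 with hu | rfl | hu
    · rw [Real.sign_of_neg hu, Real.sign_of_neg (mul_neg_of_neg_of_pos hu hc)]
    · simp
    · rw [Real.sign_of_pos hu, Real.sign_of_pos (mul_pos hu hc)]
  have habs : |ξ * x ^ (1 / α)| ^ α = |ξ| ^ α * x := by
    rw [abs_mul, abs_of_pos hc, Real.mul_rpow (abs_nonneg ξ) hc.le, ← Real.rpow_mul hx0.le,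
      one_div, inv_mul_cancel₀ hα.ne', Real.rpow_one]
  simp only [h1]
  rw [hS, hsign, habs, stableExponent]
  congr 2
  push_cast
  ring

theorem cos_half_pos (h0 : 0 < α) (h1 : α < 1) : 0 < Real.cos (Real.pi * α / 2) := by
  have := Real.pi_pos
  exact Real.cos_pos_of_mem_Ioo ⟨by nlinarith, by nlinarith⟩

theorem charFun_mixedExpLaw (h0 : 0 < α) (h1 : α < 1) {ξ : ℝ} (hξ : ξ ≠ 0) :
    charFun (mixedExpLaw α) ξ = 1 / (1 + stableExponent α ξ) := by
  have hpi := Real.pi_pos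
  have hk := cos_half_pos h0 h1
  set k := Real.cos (Real.pi * α / 2) with hkdef
  have hfin := isFiniteMeasure_halfLineMeasure (integrable_stableWeight h0 h1).integrableOn
  have hξ0 : 0 < |ξ| := abs_pos.2 hξ
  have hsgn : Real.sign ξ = 1 ∨ Real.sign ξ = -1 := by
    rcases lt_or_gt_of_ne hξ with h | h
    · exact Or.inr (Real.sign_of_neg h)
    · exact Or.inl (Real.sign_of_pos h)
  have hsgnξ : Real.sign ξ * |ξ| = ξ := by
    rcases lt_or_gt_of_ne hξ with h | h
    · rw [Real.sign_of_neg h, abs_of_neg h]; ring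
    · rw [Real.sign_of_pos h, abs_of_pos h]; ring
  -- `x` is the logarithm of `-i ξ / k^{1/α}`
  let x : ℂ := ((Real.log |ξ| - Real.log k / α : ℝ) : ℂ) +
    ((-(Real.pi / 2 * Real.sign ξ) : ℝ) : ℂ) * Complex.I
  have hxim : |x.im| ≤ Real.pi / 2 := by
    have : x.im = -(Real.pi / 2 * Real.sign ξ) := by simp [x]
    rw [this, abs_neg]
    rcases hsgn with h | h <;> rw [h] <;> simp [abs_of_pos (half_pos hpi)]
  have hexpx : Complex.exp x = -(ξ * Complex.I) / ((k ^ (1 / α) : ℝ) : ℂ) := by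
    have hre : Real.exp (Real.log |ξ| - Real.log k / α) = |ξ| / k ^ (1 / α) := by
      rw [Real.exp_sub, Real.exp_log hξ0, Real.rpow_def_of_pos hk]
      congr 2
      ring
    have him : Complex.exp (((-(Real.pi / 2 * Real.sign ξ) : ℝ) : ℂ) * Complex.I) =
        -(Real.sign ξ * Complex.I) := by
      rw [Complex.exp_mul_I, ← Complex.ofReal_cos, ← Complex.ofReal_sin, Real.cos_neg, Real.sin_neg]
      rcases hsgn with h | h <;> rw [h] <;> simp
    simp only [x]
    rw [Complex.exp_add, ← Complex.ofReal_exp, hre, him]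
    rw [show (ξ : ℂ) = Real.sign ξ * |ξ| by exact_mod_cast hsgnξ.symm]
    push_cast
    ring
  have hexpαx : Complex.exp (α * x) = stableExponent α ξ := by
    have hx' : (α * x : ℂ) = ((α * Real.log |ξ| - Real.log k : ℝ) : ℂ) +
        ((-(Real.pi * α / 2 * Real.sign ξ) : ℝ) : ℂ) * Complex.I := by
      have : (α : ℂ) ≠ 0 := by exact_mod_cast h0.ne'
      simp only [x]
      push_cast
      field_simp
    have hre : Real.exp (α * Real.log |ξ| - Real.log k) = |ξ| ^ α / k := by
      rw [Real.exp_sub, Real.exp_log hk, Real.rpow_def_of_pos hξ0, mul_comm]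
    have hcos : Real.cos (-(Real.pi * α / 2 * Real.sign ξ)) = k := by
      rcases hsgn with h | h <;> rw [h] <;> simp [hkdef]
    have hsin : Real.sin (-(Real.pi * α / 2 * Real.sign ξ)) =
        -(Real.sign ξ * Real.sin (Real.pi * α / 2)) := by
      rcases hsgn with h | h <;> rw [h] <;> simp
    rw [hx', Complex.exp_add, ← Complex.ofReal_exp, hre, Complex.exp_mul_I, ← Complex.ofReal_cos,
      ← Complex.ofReal_sin, hcos, hsin, stableExponent, Real.tan_eq_sin_div_cos, ← hkdef]
    have : (k : ℂ) ≠ 0 := by exact_mod_cast hk.ne'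
    push_cast
    field_simp
    ring
  have hmain := integral_stableWeight_mul h0 h1 hxim
  rw [hexpαx, hexpx] at hmain
  rw [← hmain, mixedExpLaw, charFun_map_prod (by fun_prop),
    integral_halfLineMeasure (continuous_stableWeight h0 h1).measurable
      (stableWeight_nonneg h0 h1)]
  refine setIntegral_congr_fun measurableSet_Ioi fun u hu => ?_
  have hu0 : 0 < u := hu
  have hru : 0 < u ^ (1 / α) := Real.rpow_pos_of_pos hu0 _
  have hrk : 0 < k ^ (1 / α) := Real.rpow_pos_of_pos hk _
  have hinner := integral_expLaw_exp (θ := -(ξ * Complex.I) / (((u * k) ^ (1 / α) : ℝ) : ℂ)) (by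
    rw [Complex.div_ofReal_re]
    simp)
  have hcong : ∀ y : ℝ, Complex.exp (ξ * ((y / (u * k) ^ (1 / α) : ℝ) : ℂ) * Complex.I) =
      Complex.exp (-(y * (-(ξ * Complex.I) / (((u * k) ^ (1 / α) : ℝ) : ℂ)))) := by
    intro y
    congr 1
    push_cast
    ring
  simp only [← hkdef, hcong]
  rw [hinner, Complex.real_smul, Real.mul_rpow hu0.le hk.le]
  congr 1
  have e1 : ((u ^ (1 / α) : ℝ) : ℂ) ≠ 0 := by exact_mod_cast hru.ne'
  have e2 : ((k ^ (1 / α) : ℝ) : ℂ) ≠ 0 := by exact_mod_cast hrk.ne'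
  rw [Complex.ofReal_mul]
  generalize ((u ^ (1 / α) : ℝ) : ℂ) = a at *
  generalize ((k ^ (1 / α) : ℝ) : ℂ) = b at *
  field_simp

/-- The two laws agree, as they have the same characteristic function. -/
theorem mixedStableLaw_eq_mixedExpLaw (h0 : 0 < α) (h1 : α < 1) (hS : IsOneSidedStable α ψ) :
    mixedStableLaw α ψ = mixedExpLaw α := by
  have hfin := isFiniteMeasure_halfLineMeasure (integrable_stableWeight h0 h1).integrableOn
  have hf1 : IsFiniteMeasure (mixedStableLaw α ψ) := by
    unfold mixedStableLaw; infer_instance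
  have hf2 : IsFiniteMeasure (mixedExpLaw α) := by
    unfold mixedExpLaw; infer_instance
  refine Measure.ext_of_charFun (Continuous.ext_on (dense_compl_singleton (0 : ℝ))
    continuous_charFun continuous_charFun fun ξ hξ => ?_)
  rw [charFun_mixedStableLaw h0 hS, charFun_mixedExpLaw h0 h1 hξ]

theorem stableCoeff_eq_real (h0 : 0 < α) (h1 : α < 1) {t : ℝ} (ht : 0 ≤ t) :
    stableCoeff α 1 t = (mixedExpLaw α).real (Set.Ioi t) := by
  have hk := cos_half_pos h0 h1
  have hfin := isFiniteMeasure_halfLineMeasure (integrable_stableWeight h0 h1).integrableOn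
  rw [mixedExpLaw, real_map_prod (by fun_prop) measurableSet_Ioi,
    integral_halfLineMeasure (continuous_stableWeight h0 h1).measurable
      (stableWeight_nonneg h0 h1), stableCoeff, ← integral_const_mul]
  refine setIntegral_congr_fun measurableSet_Ioi fun u hu => ?_
  have hu0 : 0 < u := hu
  have hr : 0 < (u * Real.cos (Real.pi * α / 2)) ^ (1 / α) :=
    Real.rpow_pos_of_pos (mul_pos hu0 hk) _
  have hset : {y : ℝ | y / (u * Real.cos (Real.pi * α / 2)) ^ (1 / α) ∈ Set.Ioi t} =
      Set.Ioi (t * (u * Real.cos (Real.pi * α / 2)) ^ (1 / α)) := by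
    ext y
    simp only [Set.mem_Ioi, Set.mem_ofPred_eq]
    rw [lt_div_iff₀ hr]
  simp only [hset]
  rw [expLaw_real_Ioi (by positivity), stableWeight, smul_eq_mul, Nat.cast_one, one_mul]
  ring

theorem mixedStableLaw_real_Ioi {t : ℝ} :
    (mixedStableLaw α ψ).real (Set.Ioi t) =
      1 - ∫ x in Set.Ioi (0 : ℝ), Real.exp (-x) * ψ.real (Set.Iic (t / x ^ (1 / α))) := by
  have hmeas : Measurable fun y => ψ.real (Set.Iic y) :=
    Monotone.measurable fun a b hab => measureReal_mono (Set.Iic_subset_Iic.2 hab)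
  have hint : IntegrableOn (fun x : ℝ => Real.exp (-x) * ψ.real (Set.Iic (t / x ^ (1 / α))))
      (Set.Ioi 0) := by
    refine (integrableOn_exp_neg_Ioi 0).mono' (Measurable.aestronglyMeasurable
      (Measurable.mul (by fun_prop) (hmeas.comp (by fun_prop)))) (Eventually.of_forall fun x => ?_)
    rw [Real.norm_of_nonneg (by positivity)]
    exact mul_le_of_le_one_right (Real.exp_pos _).le measureReal_le_one
  have hone : ∫ x in Set.Ioi (0 : ℝ), Real.exp (-x) = 1 := by
    rw [integral_exp_neg_Ioi]; simp
  rw [mixedStableLaw, real_map_prod (by fun_prop) measurableSet_Ioi, integral_expLaw]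
  refine Eq.trans ?_ (congrArg (· - _) hone)
  rw [← integral_sub (integrableOn_exp_neg_Ioi 0) hint]
  refine setIntegral_congr_fun measurableSet_Ioi fun x hx => ?_
  have hc : 0 < x ^ (1 / α) := Real.rpow_pos_of_pos hx _
  have hset : {y : ℝ | x ^ (1 / α) * y ∈ Set.Ioi t} = (Set.Iic (t / x ^ (1 / α)))ᶜ := by
    ext y
    simp only [Set.mem_Ioi, Set.mem_ofPred_eq, Set.compl_Iic]
    rw [div_lt_iff₀ hc, mul_comm]
  simp only [hset]
  rw [probReal_compl_eq_one_sub measurableSet_Iic, smul_eq_mul]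
  ring

theorem tendsto_pauseCoeff_stableCoeff (hψ : ψ (Set.Iic 0) = 0) (h0 : 0 < α) (h1 : α < 1)
    (hS : IsOneSidedStable α ψ) {t : ℝ} (ht : 0 ≤ t) :
    Tendsto (fun n : ℕ => pauseCoeff ψ 1 n (t * (n : ℝ) ^ (1 / α))) atTop
      (𝓝 (stableCoeff α 1 t)) := by
  rw [stableCoeff_eq_real h0 h1 ht, ← mixedStableLaw_eq_mixedExpLaw h0 h1 hS,
    mixedStableLaw_real_Ioi]
  exact tendsto_pauseCoeff_stable hψ h0 hS ht

theorem tendsto_stableCoeff_atTop (h0 : 0 < α) (h1 : α < 1) :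
    Tendsto (stableCoeff α 1) atTop (𝓝 0) := by
  have hfin := isFiniteMeasure_halfLineMeasure (integrable_stableWeight h0 h1).integrableOn
  have hf2 : IsFiniteMeasure (mixedExpLaw α) := by
    unfold mixedExpLaw; infer_instance
  have hlim := tendsto_measure_iInter_atTop (μ := mixedExpLaw α) (s := fun t : ℝ => Set.Ioi t)
    (fun t => measurableSet_Ioi.nullMeasurableSet) (fun a b hab => Set.Ioi_subset_Ioi hab)
    ⟨0, measure_ne_top _ _⟩
  have hempty : ⋂ t : ℝ, Set.Ioi t = ∅ := by
    rw [Set.eq_empty_iff_forall_notMem]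
    intro y hy
    exact lt_irrefl y (Set.mem_iInter.1 hy y)
  rw [hempty, measure_empty] at hlim
  have hreal := (ENNReal.tendsto_toReal ENNReal.zero_ne_top).comp hlim
  rw [ENNReal.toReal_zero] at hreal
  refine hreal.congr' ?_
  filter_upwards [eventually_ge_atTop 0] with t ht
  rw [stableCoeff_eq_real h0 h1 ht]
  rfl

theorem tendsto_finiteMeanCoeff_atTop (hψ : ψ (Set.Iic 0) = 0)
    (hint : Integrable (fun x : ℝ => x) ψ) :
    Tendsto (finiteMeanCoeff ψ 1) atTop (𝓝 0) := by
  have hm := mean_pos hψ hint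
  have h : Tendsto (fun t : ℝ => -((1 : ℕ) * t / ∫ x, x ∂ψ)) atTop atBot := by
    simp only [Nat.cast_one, one_mul]
    exact tendsto_neg_atTop_atBot.comp (tendsto_id.atTop_div_const hm)
  exact Real.tendsto_exp_atBot.comp h

end

end ResInd

end

theorem theorem3p3 {T : Type*} [Group T] [Finite T]
    -- the pausing time distribution, a probability on `(0, ∞)`
    (ψ : Measure ℝ) [IsProbabilityMeasure ψ] (hψ : ψ (Set.Iic 0) = 0)
    -- the time scale `τ_n` and the coefficient `a₁(t)` of the two admissible regimes
    (τ : ℕ → ℝ) (a₁ : ℝ → ℝ)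
    (hreg :
      (ResInd.IsFiniteMeanPausing ψ ∧ (∀ n : ℕ, τ n = n) ∧
        ∀ t : ℝ, a₁ t = ResInd.finiteMeanCoeff ψ 1 t) ∨
      (∃ α : ℝ, 0 < α ∧ α < 1 ∧ ResInd.IsOneSidedStable α ψ ∧
        (∀ n : ℕ, τ n = (n : ℝ) ^ (1 / α)) ∧
        ∀ t : ℝ, a₁ t = ResInd.stableCoeff α 1 t))
    -- for each `n ≥ 1`, a Res-Ind chain with independent pausing times
    {Ω : ℕ → Type*} [∀ n, MeasurableSpace (Ω n)]
    (Pr : ∀ n, Measure (Ω n)) [∀ n, IsProbabilityMeasure (Pr n)]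
    (Z : ∀ n, ℕ → Ω n → ResInd.MultiDiagram T n) (ε : ∀ n, ℕ → Ω n → ℝ)
    (hX : ∀ n, 1 ≤ n → ResInd.IsPausedChain ψ (Pr n) (Z n) (ε n))
    -- the assumption on the initial ensembles
    (x : ResInd.Irr T → ℝ)
    (h₀ : ∀ ζ : ResInd.Irr T,
      Tendsto (fun n : ℕ => ResInd.meanSize (Pr n) (Z n) (ε n) ζ 0) atTop (𝓝 (x ζ))) :
    -- `a₁(t)` is the limit of `a(1, n, t τ_n)`
    (∀ t : ℝ, 0 ≤ t →
      Tendsto (fun n : ℕ => ResInd.pauseCoeff ψ 1 n (t * τ n)) atTop (𝓝 (a₁ t))) ∧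
    -- evolution of the averaged sizes
    (∀ t : ℝ, 0 ≤ t → ∀ ζ : ResInd.Irr T,
      Tendsto (fun n : ℕ => ResInd.meanSize (Pr n) (Z n) (ε n) ζ (t * τ n)) atTop
        (𝓝 ((1 - a₁ t) * ((ζ.dim : ℝ) ^ 2 / Nat.card T) + a₁ t * x ζ))) ∧
    -- as `t → ∞` the limiting averaged sizes tend to the Plancherel measure of `T`
    (∀ ζ : ResInd.Irr T,
      Tendsto (fun t : ℝ => (1 - a₁ t) * ((ζ.dim : ℝ) ^ 2 / Nat.card T) + a₁ t * x ζ) atTop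
        (𝓝 (ResInd.plancherel ζ))) := by
  have h₁ : ∀ t : ℝ, 0 ≤ t →
      Tendsto (fun n : ℕ => ResInd.pauseCoeff ψ 1 n (t * τ n)) atTop (𝓝 (a₁ t)) := by
    intro t ht
    rcases hreg with ⟨⟨hint, -⟩, hτ, ha⟩ | ⟨α, h0, h1, hS, hτ, ha⟩
    · simp only [hτ, ha]
      exact (hX 1 le_rfl).tendsto_pauseCoeff_of_integrable hψ hint ht
    · simp only [hτ, ha]
      exact ResInd.tendsto_pauseCoeff_stableCoeff hψ h0 h1 hS ht
  have hτ0 : ∀ n, 0 ≤ τ n := by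
    intro n
    rcases hreg with ⟨-, hτ, -⟩ | ⟨α, -, -, -, hτ, -⟩ <;> rw [hτ] <;> positivity
  have h₂ : Tendsto a₁ atTop (𝓝 0) := by
    rcases hreg with ⟨⟨hint, -⟩, -, ha⟩ | ⟨α, h0, h1, -, -, ha⟩
    · rw [funext ha]
      exact ResInd.tendsto_finiteMeanCoeff_atTop hψ hint
    · rw [funext ha]
      exact ResInd.tendsto_stableCoeff_atTop h0 h1
  refine ⟨h₁, fun t ht ζ => ?_, fun ζ => ?_⟩
  · have hlim := ((h₁ t ht).mul ((h₀ ζ).sub_const (ResInd.plancherel ζ))).const_add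
      (ResInd.plancherel ζ)
    rw [show (1 - a₁ t) * ((ζ.dim : ℝ) ^ 2 / Nat.card T) + a₁ t * x ζ =
      ResInd.plancherel ζ + a₁ t * (x ζ - ResInd.plancherel ζ) by
        rw [ResInd.plancherel]; ring]
    refine hlim.congr' ?_
    filter_upwards [eventually_ge_atTop 1] with n hn
    rw [(hX n hn).meanSize_eq hn hψ ζ (mul_nonneg ht (hτ0 n)), (hX n hn).meanSize_zero hψ ζ]
  · have hlim := ((h₂.const_sub 1).mul_const (ResInd.plancherel ζ)).add (h₂.mul_const (x ζ))
    simpa [ResInd.plancherel] using hlim
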